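/- Let $G$ be a locally compact, second countable (Hausdorff) topological group with identity $e$, let $\mu$ be a left Haar measure on $G$, and let the scalar field be $\mathbb{R}$ or $\mathbb{C}$. Let $$X=\bigoplus_{n=1}^{\infty}L^{2n}(G,\mu)\quad\text{(in the $\ell^2$-sense)},\qquad \|(\xi_n)_n\|_X^2=\sum_{n\ge 1}\|\xi_n\|_{2n}^2 .$$ Then $X$ is a separable, strictly convex, reflexive Banach space, and $G$ admits a continuous proper affine isometric action $\alpha$ on $X$. That is, there is a homomorphism $\alpha$ from $G$ to the group of affine isometric bijections of $X$ such that $g\mapsto\alpha(g)\xi$ is continuous for every $\xi\in X$, and $\|\alpha(g)\xi\|\to\infty$ as $g\to\infty$ in $G$ (i.e. as $g$ leaves every compact subset of $G$) for every $\xi\in X$. More precisely, there is a metric $d$ on $G$ which is proper (closed bounded sets are compact), is left invariant, generates the topology of $G$, and has exponentially controlled growth of balls, i.e. for some constants $a,b>0$, $$\mu(\{y\in G: d(e,y)<n\})\le c\,e^{a n}\quad\text{for all } n\in\mathbb{N},$$ and there is an action $\alpha$ as above of the form $\alpha(g)\xi=\lambda(g)\xi+b(g)$, where $\lambda$ is the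 left regular representation, $(\lambda(g)\xi)_n(h)=\xi_n(g^{-1}h)$, and the cocycle is $$b(g)=\bigoplus_{n\ge1}\bigl(\lambda(g)\varphi_n-\varphi_n\bigr)\in X,\qquad \varphi_n(y)=\begin{cases}1-\dfrac{d(e,y)}{n}, & d(e,y)\le n,\\[1ex] 0,& d(e,y)\ge n.\end{cases}$$ Each $\varphi_n$ is $\tfrac1n$-Lipschitz with respect to $d$. -/

import Mathlib

open MeasureTheory Filter Topology
open scoped ENNReal

/-- A metric on a topological group `G` is a *plig metric* if it is proper, left invariant and
generates the given topology of `G`. -/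
structure IsPligMetric {G : Type*} [Group G] [τ : TopologicalSpace G] (d : MetricSpace G) :
    Prop where
  proper : @ProperSpace G d.toPseudoMetricSpace
  left_invariant : ∀ g x y : G, d.dist (g * x) (g * y) = d.dist x y
  generates : d.toUniformSpace.toTopologicalSpace = τ

/-- The open balls of `d` around the identity have exponentially controlled `μ`-growth:
`μ (B_d(e, n)) ≤ β * exp (α * n)` for all natural numbers `n`, for some `α, β > 0`. -/
def HasExpGrowth {G : Type*} [Group G] [MeasurableSpace G] (μ : Measure G) (d : MetricSpace G) :
    Prop :=
  ∃ a b : ℝ, 0 < a ∧ 0 < b ∧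
    ∀ n : ℕ, μ {y : G | d.dist 1 y < n} ≤ ENNReal.ofReal (b * Real.exp (a * n))

/-- The bump function `φ_n(y) = 1 - d(e, y) / n` if `d(e, y) ≤ n`, and `φ_n(y) = 0` otherwise. -/
noncomputable def bump {G : Type*} [Group G] (d : MetricSpace G) (n : ℕ+) (y : G) : ℝ :=
  open Classical in if d.dist 1 y ≤ (n : ℕ) then 1 - d.dist 1 y / (n : ℕ) else 0

instance fact_one_le_two_mul (n : ℕ+) : Fact ((1 : ℝ≥0∞) ≤ ((2 * (n : ℕ) : ℕ) : ℝ≥0∞)) :=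
  ⟨by exact_mod_cast (by have := n.pos; omega : 1 ≤ 2 * (n : ℕ))⟩

/-- The Banach space `⨁_{n ≥ 1} L^{2n}(G, μ)` of `𝕜`-valued functions, the sum being taken in the
`ℓ²`-sense: sequences `ξ = (ξ_n)` with `ξ_n ∈ L^{2n}(G, μ)` and `‖ξ‖² = ∑ ‖ξ_n‖² < ∞`. -/
abbrev SumLp (𝕜 : Type*) [RCLike 𝕜] {G : Type*} [MeasurableSpace G] (μ : Measure G) : Type _ :=
  lp (fun n : ℕ+ => Lp 𝕜 ((2 * (n : ℕ) : ℕ) : ℝ≥0∞) μ) 2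

/-- A normed space is reflexive if the canonical embedding into its bidual is onto. -/
def IsReflexiveSpace (𝕜 : Type*) [RCLike 𝕜] (E : Type*) [NormedAddCommGroup E]
    [NormedSpace 𝕜 E] : Prop :=
  Function.Surjective (NormedSpace.inclusionInDoubleDual 𝕜 E)

/-- An isometric representation `π` on `⨁ L^{2n}(G, μ)` is the left regular one if it acts by
`(π(g) ξ)_n (h) = ξ_n (g⁻¹ h)`, as elements of `L^{2n}(G, μ)`, i.e. for almost every `h`. -/
def IsLeftRegularRep {𝕜 : Type*} [RCLike 𝕜] {G : Type*} [Group G] [MeasurableSpace G]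
    {μ : Measure G} (π : G → SumLp 𝕜 μ ≃ₗᵢ[𝕜] SumLp 𝕜 μ) : Prop :=
  ∀ (g : G) (ξ : SumLp 𝕜 μ) (n : ℕ+), ⇑((π g ξ) n) =ᵐ[μ] fun h => ξ n (g⁻¹ * h)

/-- An action of `G` by affine isometries of a normed space is proper if
`‖α(g) ξ‖ → ∞` as `g → ∞` in `G`, for every vector `ξ`. -/
def IsProperAffineAction {𝕜 : Type*} [RCLike 𝕜] {G : Type*} [Group G] [TopologicalSpace G]
    {E : Type*} [NormedAddCommGroup E] [NormedSpace 𝕜 E] (α : G →* (E ≃ᵃⁱ[𝕜] E)) : Prop :=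
  ∀ ξ : E, Tendsto (fun g : G => ‖α g ξ‖) (cocompact G) atTop

/-!
The theorem has two independent halves.

**The Banach space.** Clarkson's inequality for an even exponent
(`Lp.norm_add_pow_add_norm_sub_pow_le`) makes every `L^{2n}` uniformly convex, hence strictly
convex, and reflexive by the Milman–Pettis theorem (`IsReflexiveSpace.of_uniformConvexSpace`). The
moduli of convexity degenerate as `n` grows, so the `ℓ²`-sum need not be uniformly convex; strict
convexity and reflexivity are instead passed to the sum coordinatewise (`StrictConvexSpace.lp_two`,
`IsReflexiveSpace.lp_two`). For reflexivity, every functional on the sum is the norm-convergent sum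
of its restrictions to the summands (`lp.hasSum_dualSingle`), so an element of the bidual is
determined by its components, which are represented by vectors with square-summable norms.

**The metric and the action.** By first countability there is a length function `p` whose balls
form a basis at the identity (`exists_lengthFunction_hasBasis`). It is made proper by passing to a
weighted word length: letters with `p < 1` have weight `p`, and the other letters, taken from the
`k`-th set `K k` of a compact exhaustion, have weight `N k + k`, where `N k` bounds the number of
translates of a compact neighbourhood `U` of the identity needed to cover `U * K k`. Since adjacent
small letters can be merged, an element of length less than `n` is a product of at most `2 n + 1`
letters (`exists_mul_prod_mem_wordSet`), and since `∑ N k * exp (-(N k + k))` converges, such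
products fill a set of exponentially bounded measure (`measure_mul_wordSet_le`).

For this metric, `λ(g) φ_n - φ_n` is bounded by `d(e, g) / n` and lives on a set of measure at most
exponential in `n`, so that its `2n`-norm is `O(d(e, g) / n)` uniformly in `n`
(`exists_norm_bumpCoboundary_le`); hence the cocycle lies in the `ℓ²`-sum and is continuous. When
`n ≤ d(e, g) / 2` the functions `φ_n` and `λ(g) φ_n` have disjoint supports, and the norm of their
difference is at least a positive constant (`exists_le_norm_bumpCoboundary`); as the number of such
`n` tends to infinity with `g`, the action is proper.
-/

/-! ### Goldstine's theorem and the Milman–Pettis theorem -/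

section Goldstine

variable {𝕜 : Type*} [RCLike 𝕜] {E : Type*} [NormedAddCommGroup E] [NormedSpace 𝕜 E]

theorem exists_norm_eq_one_re_mul_eq_norm (z : 𝕜) :
    ∃ c : 𝕜, ‖c‖ = 1 ∧ RCLike.re (c * z) = ‖z‖ := by
  obtain ⟨c, hc, h⟩ := RCLike.exists_norm_eq_mul_self z
  exact ⟨c, hc, by rw [← h, RCLike.ofReal_re]⟩

/-- **Goldstine's theorem**, for finitely many functionals: an element `φ` of the unit ball of the
bidual is approximated by elements of the unit ball of the space. -/
theorem mem_closure_image_closedBall_of_bidual {φ : StrongDual 𝕜 (StrongDual 𝕜 E)} (hφ : ‖φ‖ ≤ 1)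
    {ι : Type*} [Finite ι] (f : ι → StrongDual 𝕜 E) :
    (fun i => φ (f i)) ∈ closure ((fun x i => f i x) '' Metric.closedBall (0 : E) 1) := by
  classical
  have := Fintype.ofFinite ι
  let _ : NormedSpace ℝ E := NormedSpace.restrictScalars ℝ 𝕜 E
  have : IsScalarTower ℝ 𝕜 E := RestrictScalars.isScalarTower ℝ 𝕜 E
  let T : E →L[𝕜] (ι → 𝕜) := ContinuousLinearMap.pi f
  have hT : ((fun x i => f i x) : E → ι → 𝕜) = (T.restrictScalars ℝ : E →L[ℝ] ι → 𝕜) := rfl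
  have hconv : Convex ℝ (closure ((fun x i => f i x) '' Metric.closedBall (0 : E) 1)) := by
    rw [hT]
    exact ((convex_closedBall (0 : E) 1).is_linear_image
      (T.restrictScalars ℝ : E →L[ℝ] ι → 𝕜).isLinear).closure
  by_contra hmem
  obtain ⟨g, u, hu, hlt⟩ :=
    RCLike.geometric_hahn_banach_closed_point (𝕜 := 𝕜) hconv isClosed_closure hmem
  have hu' : ∀ x : E, ‖x‖ ≤ 1 → RCLike.re (g (T x)) < u := fun x hx =>
    hu _ (subset_closure ⟨x, by simpa using hx, rfl⟩)
  have hu0 : 0 < u := by simpa using hu' 0 (by simp)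
  have hnorm : ‖g.comp T‖ ≤ u := by
    refine ContinuousLinearMap.opNorm_le_of_unit_norm hu0.le fun x hx => ?_
    obtain ⟨c, hc, hcx⟩ := exists_norm_eq_one_re_mul_eq_norm (g (T x))
    have := hu' (c • x) (by rw [norm_smul, hc, hx, one_mul])
    rw [map_smul, map_smul, smul_eq_mul, hcx] at this
    exact this.le
  have hφg : φ (g.comp T) = g (fun i => φ (f i)) := by
    have h1 : g.comp T = ∑ i, g (Pi.single i 1) • f i := by
      ext x
      have := LinearMap.pi_apply_eq_sum_univ (g : (ι → 𝕜) →ₗ[𝕜] 𝕜) (T x)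
      simp only [ContinuousLinearMap.coe_coe, smul_eq_mul] at this
      simp only [ContinuousLinearMap.comp_apply, sum_apply, smul_apply, smul_eq_mul, this]
      refine Finset.sum_congr rfl fun i _ => ?_
      rw [mul_comm]
      congr 2
      ext j
      simp [Pi.single_apply, eq_comm]
    have := LinearMap.pi_apply_eq_sum_univ (g : (ι → 𝕜) →ₗ[𝕜] 𝕜) (fun i => φ (f i))
    simp only [ContinuousLinearMap.coe_coe, smul_eq_mul] at this
    rw [h1, this, map_sum]
    refine Finset.sum_congr rfl fun i _ => ?_
    rw [map_smul, smul_eq_mul, mul_comm]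
    congr 2
    ext j
    simp [Pi.single_apply, eq_comm]
  have h2 : RCLike.re (φ (g.comp T)) ≤ u := calc
    RCLike.re (φ (g.comp T)) ≤ ‖φ (g.comp T)‖ := RCLike.re_le_norm _
    _ ≤ ‖φ‖ * ‖g.comp T‖ := φ.le_opNorm _
    _ ≤ 1 * u := by gcongr
    _ = u := one_mul u
  rw [hφg] at h2
  exact absurd hlt (not_lt.2 h2)

/-- Near a unit vector `φ` of the bidual of a uniformly convex space, a single functional almost
norming `φ` already forces points of the unit ball to be close to each other. -/
theorem exists_functional_forall_norm_sub_lt [UniformConvexSpace E]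
    {φ : StrongDual 𝕜 (StrongDual 𝕜 E)} (hφ : ‖φ‖ = 1) {ε : ℝ} (hε : 0 < ε) :
    ∃ f : StrongDual 𝕜 E, ∃ δ : ℝ, 0 < δ ∧ ∀ x y : E, ‖x‖ ≤ 1 → ‖y‖ ≤ 1 →
      ‖f x - φ f‖ < δ → ‖f y - φ f‖ < δ → ‖x - y‖ < ε := by
  let _ : NormedSpace ℝ E := NormedSpace.restrictScalars ℝ 𝕜 E
  obtain ⟨δ, hδ, H⟩ := exists_forall_closed_ball_dist_add_le_two_sub E hε
  obtain ⟨f, hf, hlt⟩ := φ.exists_lt_apply_of_lt_opNorm (show 1 - δ / 4 < ‖φ‖ by linarith)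
  obtain ⟨c, hc, hcf⟩ := exists_norm_eq_one_re_mul_eq_norm (φ f)
  refine ⟨c • f, δ / 4, by positivity, fun x y hx hy hfx hfy => ?_⟩
  by_contra! hxy
  have h1 : ‖x + y‖ ≤ 2 - δ := H hx hy hxy
  have h2 : ∀ z : E, ‖(c • f) z - φ (c • f)‖ < δ / 4 → 1 - δ / 2 < RCLike.re ((c • f) z) := by
    intro z hz
    have h3 : RCLike.re (φ (c • f)) = ‖φ f‖ := by rw [map_smul, smul_eq_mul, hcf]
    have h4 := (abs_le.1 ((RCLike.abs_re_le_norm _).trans hz.le)).1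
    rw [map_sub, h3] at h4
    linarith
  have h5 : RCLike.re ((c • f) (x + y)) ≤ ‖x + y‖ := calc
    RCLike.re ((c • f) (x + y)) ≤ ‖(c • f) (x + y)‖ := RCLike.re_le_norm _
    _ ≤ ‖c • f‖ * ‖x + y‖ := (c • f).le_opNorm _
    _ ≤ 1 * ‖x + y‖ := by
      gcongr
      rw [norm_smul, hc, one_mul]
      exact hf.le
    _ = ‖x + y‖ := one_mul _
  rw [map_add, map_add] at h5
  linarith [h2 x hfx, h2 y hfy]

set_option maxSynthPendingDepth 3 in
/-- The **Milman–Pettis theorem**: a uniformly convex Banach space is reflexive. The points of the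
unit ball that are weak-* close to a unit vector `φ` of the bidual form a Cauchy filter, and its
limit represents `φ`. -/
theorem IsReflexiveSpace.of_uniformConvexSpace [UniformConvexSpace E] [CompleteSpace E] :
    IsReflexiveSpace 𝕜 E := by
  suffices H : ∀ φ : StrongDual 𝕜 (StrongDual 𝕜 E), ‖φ‖ = 1 →
      ∃ x, NormedSpace.inclusionInDoubleDual 𝕜 E x = φ by
    intro φ
    rcases eq_or_ne φ 0 with rfl | hφ
    · exact ⟨0, map_zero _⟩
    · have hn : (‖φ‖ : 𝕜) ≠ 0 := by simpa using hφ
      obtain ⟨x, hx⟩ := H ((‖φ‖ : 𝕜)⁻¹ • φ) (by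
        rw [norm_smul, norm_inv, RCLike.norm_ofReal, abs_norm,
          inv_mul_cancel₀ (norm_ne_zero_iff.2 hφ)])
      exact ⟨(‖φ‖ : 𝕜) • x, by rw [map_smul, hx, smul_inv_smul₀ hn]⟩
  intro φ hφ
  let ev : E → StrongDual 𝕜 E → 𝕜 := fun x f => f x
  let l : Filter E := comap ev (𝓝 ⇑φ) ⊓ 𝓟 (Metric.closedBall 0 1)
  have hl : l.NeBot := by
    rw [inf_principal_neBot_iff]
    rintro U ⟨s, hs, hsU⟩
    rw [nhds_pi, Filter.mem_pi] at hs
    obtain ⟨I, hI, t, ht, hts⟩ := hs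
    have := hI.to_subtype
    obtain ⟨_, hxt, x, hx, rfl⟩ := mem_closure_iff_nhds.1
      (mem_closure_image_closedBall_of_bidual hφ.le (fun f : I => (f : StrongDual 𝕜 E)))
      (Set.pi Set.univ fun i : I => t i)
      (set_pi_mem_nhds Set.finite_univ fun i _ => ht i)
    exact ⟨x, hsU (hts fun f hf => hxt ⟨f, hf⟩ (Set.mem_univ _)), hx⟩
  have htend : ∀ f : StrongDual 𝕜 E, Tendsto (fun x => f x) l (𝓝 (φ f)) := fun f =>
    ((continuous_apply f).tendsto ⇑φ).comp (tendsto_comap.mono_left inf_le_left)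
  have hcauchy : Cauchy l := by
    rw [Metric.cauchy_iff]
    refine ⟨hl, fun ε hε => ?_⟩
    obtain ⟨f, δ, hδ, H⟩ := exists_functional_forall_norm_sub_lt hφ hε
    have h1 : ∀ᶠ x in l, ‖f x - φ f‖ < δ := by
      simpa [dist_eq_norm] using (htend f).eventually (Metric.ball_mem_nhds _ hδ)
    have h2 : ∀ᶠ x in l, ‖x‖ ≤ 1 := by
      have : Metric.closedBall (0 : E) 1 ∈ l := mem_inf_of_right (mem_principal_self _)
      simpa [Filter.Eventually, Metric.closedBall] using this
    refine ⟨_, h1.and h2, fun x hx y hy => ?_⟩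
    rw [dist_eq_norm]
    exact H x y hx.2 hy.2 hx.1 hy.1
  obtain ⟨x, hx⟩ := CompleteSpace.complete hcauchy
  refine ⟨x, ContinuousLinearMap.ext fun f => ?_⟩
  rw [NormedSpace.dual_def]
  exact tendsto_nhds_unique ((f.continuous.tendsto x).mono_left hx) (htend f)

end Goldstine

/-! ### Hilbert sums: reflexivity, strict convexity, separability -/

section HilbertSum

variable {ι : Type*} {E : ι → Type*} [∀ i, NormedAddCommGroup (E i)]

theorem lp.hasSum_norm_sq (x : lp E 2) : HasSum (fun i => ‖x i‖ ^ 2) (‖x‖ ^ 2) := by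
  simpa using lp.hasSum_norm (p := 2) (by simp) x

theorem lp.sum_norm_sq_le (x : lp E 2) (s : Finset ι) : ∑ i ∈ s, ‖x i‖ ^ 2 ≤ ‖x‖ ^ 2 :=
  sum_le_hasSum s (fun _ _ => by positivity) (lp.hasSum_norm_sq x)

theorem memℓp_two_of_sum_norm_sq_le {f : ∀ i, E i} {C : ℝ}
    (h : ∀ s : Finset ι, ∑ i ∈ s, ‖f i‖ ^ 2 ≤ C) : Memℓp f 2 :=
  memℓp_gen' (C := C) fun s => by simpa using h s

theorem memℓp_two_of_summable {f : ∀ i, E i} (h : Summable fun i => ‖f i‖ ^ 2) : Memℓp f 2 :=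
  memℓp_gen (by simpa using h)

theorem lp.norm_sum_single_sq [DecidableEq ι] (x : ∀ i, E i) (s : Finset ι) :
    ‖∑ i ∈ s, lp.single 2 i (x i)‖ ^ 2 = ∑ i ∈ s, ‖x i‖ ^ 2 := by
  simpa using lp.norm_sum_single (p := 2) (by simp) x s

variable {𝕜 : Type*} [RCLike 𝕜] [∀ i, NormedSpace 𝕜 (E i)]

/-- The functional on an `ℓ²`-sum that applies `f` to the `i`-th coordinate, as a continuous linear
function of `f`. -/
noncomputable def lp.dualSingle (𝕜 : Type*) [RCLike 𝕜] {ι : Type*} (E : ι → Type*)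
    [∀ i, NormedAddCommGroup (E i)] [∀ i, NormedSpace 𝕜 (E i)] (i : ι) :
    StrongDual 𝕜 (E i) →L[𝕜] StrongDual 𝕜 (lp E 2) :=
  ContinuousLinearMap.precomp 𝕜 (lp.evalCLM 𝕜 E 2 i)

@[simp]
theorem lp.dualSingle_apply (i : ι) (f : StrongDual 𝕜 (E i)) (x : lp E 2) :
    lp.dualSingle 𝕜 E i f x = f (x i) := rfl

theorem lp.norm_sum_dualSingle_le (s : Finset ι) (f : ∀ i, StrongDual 𝕜 (E i)) :
    ‖∑ i ∈ s, lp.dualSingle 𝕜 E i (f i)‖ ≤ √(∑ i ∈ s, ‖f i‖ ^ 2) := by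
  refine ContinuousLinearMap.opNorm_le_bound _ (Real.sqrt_nonneg _) fun x => ?_
  rw [sum_apply]
  calc ‖∑ i ∈ s, lp.dualSingle 𝕜 E i (f i) x‖ ≤ ∑ i ∈ s, ‖f i‖ * ‖x i‖ :=
        norm_sum_le_of_le _ fun i _ => (f i).le_opNorm _
    _ ≤ √(∑ i ∈ s, ‖f i‖ ^ 2) * √(∑ i ∈ s, ‖x i‖ ^ 2) := Real.sum_mul_le_sqrt_mul_sqrt _ _ _
    _ ≤ √(∑ i ∈ s, ‖f i‖ ^ 2) * ‖x‖ := by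
      gcongr
      exact Real.sqrt_le_iff.2 ⟨norm_nonneg _, lp.sum_norm_sq_le x s⟩

theorem le_sq_of_le_mul_sqrt {A C : ℝ} (hA : 0 ≤ A) (h : A ≤ C * √A) : A ≤ C ^ 2 := by
  nlinarith [Real.sq_sqrt hA, Real.sqrt_nonneg A, sq_nonneg (C - √A)]

set_option maxSynthPendingDepth 3 in
/-- In a reflexive space every functional attains its norm. -/
theorem IsReflexiveSpace.exists_apply_eq_norm_sq {F : Type*} [NormedAddCommGroup F]
    [NormedSpace 𝕜 F] (hF : IsReflexiveSpace 𝕜 F) (f : StrongDual 𝕜 F) :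
    ∃ x : F, ‖x‖ ≤ ‖f‖ ∧ f x = ((‖f‖ ^ 2 : ℝ) : 𝕜) := by
  obtain ⟨ψ, hψ, hψf⟩ := exists_dual_vector'' 𝕜 f
  obtain ⟨x, rfl⟩ := hF ψ
  have hx : ‖x‖ ≤ 1 := by
    rwa [← (NormedSpace.inclusionInDoubleDualLi (𝕜 := 𝕜) (E := F)).norm_map x]
  rw [NormedSpace.dual_def] at hψf
  refine ⟨(‖f‖ : 𝕜) • x, ?_, ?_⟩
  · rw [norm_smul, RCLike.norm_ofReal, abs_norm]
    exact mul_le_of_le_one_right (norm_nonneg _) hx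
  · rw [map_smul, hψf, smul_eq_mul]
    push_cast
    ring

/-- The restrictions of a functional on an `ℓ²`-sum of reflexive spaces to the summands have
square-summable norms. -/
theorem lp.sum_norm_comp_single_sq_le [DecidableEq ι] (hE : ∀ i, IsReflexiveSpace 𝕜 (E i))
    (f : StrongDual 𝕜 (lp E 2)) (s : Finset ι) :
    ∑ i ∈ s, ‖f.comp (lp.singleContinuousLinearMap 𝕜 E 2 i)‖ ^ 2 ≤ ‖f‖ ^ 2 := by
  set g : ∀ i, StrongDual 𝕜 (E i) := fun i => f.comp (lp.singleContinuousLinearMap 𝕜 E 2 i)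
  choose x hx hgx using fun i => (hE i).exists_apply_eq_norm_sq (g i)
  set A := ∑ i ∈ s, ‖g i‖ ^ 2 with hA
  have hA0 : 0 ≤ A := by positivity
  refine le_sq_of_le_mul_sqrt hA0 ?_
  have h1 : f (∑ i ∈ s, lp.single 2 i (x i)) = (A : 𝕜) := by
    rw [map_sum, hA, RCLike.ofReal_sum]
    exact Finset.sum_congr rfl fun i _ => hgx i
  have h2 : ‖∑ i ∈ s, lp.single 2 i (x i)‖ ≤ √A := by
    refine Real.le_sqrt_of_sq_le ?_
    rw [lp.norm_sum_single_sq]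
    exact Finset.sum_le_sum fun i _ => pow_le_pow_left₀ (norm_nonneg _) (hx i) 2
  calc A = ‖f (∑ i ∈ s, lp.single 2 i (x i))‖ := by
        rw [h1, RCLike.norm_ofReal, abs_of_nonneg hA0]
    _ ≤ ‖f‖ * ‖∑ i ∈ s, lp.single 2 i (x i)‖ := f.le_opNorm _
    _ ≤ ‖f‖ * √A := by gcongr

/-- A functional on an `ℓ²`-sum of reflexive spaces is the norm-convergent sum of its
restrictions to the summands. -/
theorem lp.hasSum_dualSingle [DecidableEq ι] (hE : ∀ i, IsReflexiveSpace 𝕜 (E i))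
    (f : StrongDual 𝕜 (lp E 2)) :
    HasSum (fun i => lp.dualSingle 𝕜 E i (f.comp (lp.singleContinuousLinearMap 𝕜 E 2 i))) f := by
  set g : ∀ i, StrongDual 𝕜 (E i) := fun i => f.comp (lp.singleContinuousLinearMap 𝕜 E 2 i)
    with hg
  have hsum : Summable fun i => ‖g i‖ ^ 2 :=
    summable_of_sum_le (fun _ => by positivity) (lp.sum_norm_comp_single_sq_le hE f)
  have hS : Summable fun i => lp.dualSingle 𝕜 E i (g i) := by
    rw [summable_iff_vanishing_norm]
    intro ε hε
    obtain ⟨s, hs⟩ := summable_iff_vanishing_norm.1 hsum (ε ^ 2) (by positivity)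
    refine ⟨s, fun t ht => (lp.norm_sum_dualSingle_le t g).trans_lt ?_⟩
    rw [Real.sqrt_lt' hε]
    exact (le_abs_self _).trans_lt (hs t ht)
  convert hS.hasSum using 1
  refine lp.ext_continuousLinearMap (by simp) fun i => ContinuousLinearMap.ext fun x => ?_
  rw [ContinuousLinearMap.comp_apply, ContinuousLinearMap.comp_apply,
    lp.singleContinuousLinearMap_apply]
  have h1 := (ContinuousLinearMap.apply 𝕜 𝕜 (lp.single 2 i x : lp E 2)).hasSum hS.hasSum
  refine (hasSum_single i fun j hj => ?_).unique h1 |>.symm.trans ?_ |>.symm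
  · simp [Pi.single_eq_of_ne hj]
  · simp [hg]

/-- An element `φ` of the bidual of an `ℓ²`-sum of reflexive spaces is represented coordinatewise by
vectors `ξ i`. Testing `φ` on functionals norming finitely many `ξ i` shows that `ξ` lies in the
`ℓ²`-sum; as finitely supported functionals are dense in the dual, `ξ` represents `φ`. -/
theorem IsReflexiveSpace.lp_two (hE : ∀ i, IsReflexiveSpace 𝕜 (E i)) :
    IsReflexiveSpace 𝕜 (lp E 2) := by
  classical
  intro φ
  choose ξ hξ using fun i => hE i (φ.comp (lp.dualSingle 𝕜 E i))
  have hξ' : ∀ i (f : StrongDual 𝕜 (E i)), φ (lp.dualSingle 𝕜 E i f) = f (ξ i) := fun i f => by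
    rw [← NormedSpace.dual_def 𝕜 (E i), hξ]
    rfl
  have hmem : Memℓp ξ 2 := by
    refine memℓp_two_of_sum_norm_sq_le (C := ‖φ‖ ^ 2) fun s => ?_
    set A := ∑ i ∈ s, ‖ξ i‖ ^ 2 with hA
    have hA0 : 0 ≤ A := by positivity
    refine le_sq_of_le_mul_sqrt hA0 ?_
    choose g hg hgξ using fun i => exists_dual_vector'' 𝕜 (ξ i)
    let f : ∀ i, StrongDual 𝕜 (E i) := fun i => (‖ξ i‖ : 𝕜) • g i
    have h1 : φ (∑ i ∈ s, lp.dualSingle 𝕜 E i (f i)) = (A : 𝕜) := by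
      rw [map_sum, hA, RCLike.ofReal_sum]
      refine Finset.sum_congr rfl fun i _ => ?_
      rw [hξ', smul_apply, hgξ, smul_eq_mul]
      push_cast
      ring
    have h2 : ‖∑ i ∈ s, lp.dualSingle 𝕜 E i (f i)‖ ≤ √A := by
      refine (lp.norm_sum_dualSingle_le s f).trans (Real.sqrt_le_sqrt ?_)
      refine Finset.sum_le_sum fun i _ => pow_le_pow_left₀ (norm_nonneg _) ?_ 2
      rw [norm_smul, RCLike.norm_ofReal, abs_norm]
      exact mul_le_of_le_one_right (norm_nonneg _) (hg i)
    calc A = ‖φ (∑ i ∈ s, lp.dualSingle 𝕜 E i (f i))‖ := by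
          rw [h1, RCLike.norm_ofReal, abs_of_nonneg hA0]
      _ ≤ ‖φ‖ * ‖∑ i ∈ s, lp.dualSingle 𝕜 E i (f i)‖ := φ.le_opNorm _
      _ ≤ ‖φ‖ * √A := by gcongr
  let x : lp E 2 := ⟨ξ, hmem⟩
  refine ⟨x, ContinuousLinearMap.ext fun f => ?_⟩
  rw [NormedSpace.dual_def]
  have h1 := φ.hasSum (lp.hasSum_dualSingle hE f)
  have h2 := f.hasSum (lp.hasSum_single (by simp) x)
  refine h2.unique ?_
  convert h1 using 2 with i
  exact (hξ' i (f.comp (lp.singleContinuousLinearMap 𝕜 E 2 i))).symm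

/-- If `‖x + y‖ = 2` for unit vectors of an `ℓ²`-sum, the inequalities
`‖xᵢ + yᵢ‖² ≤ (‖xᵢ‖ + ‖yᵢ‖)² ≤ 2 ‖xᵢ‖² + 2 ‖yᵢ‖²` are all equalities, so that strict convexity of
the summands gives `xᵢ = yᵢ`. -/
theorem StrictConvexSpace.lp_two [∀ i, NormedSpace ℝ (E i)] [∀ i, StrictConvexSpace ℝ (E i)] :
    StrictConvexSpace ℝ (lp E 2) := by
  refine StrictConvexSpace.of_norm_add_ne_two fun x y hx hy hxy h => hxy ?_
  -- the terms `2 ‖xᵢ‖² + 2 ‖yᵢ‖² - ‖xᵢ + yᵢ‖²` are nonnegative and add up to `0`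
  have hsum : HasSum (fun i => 2 * ‖x i‖ ^ 2 + 2 * ‖y i‖ ^ 2 - ‖(x + y) i‖ ^ 2) 0 := by
    have := (((lp.hasSum_norm_sq x).mul_left 2).add ((lp.hasSum_norm_sq y).mul_left 2)).sub
      (lp.hasSum_norm_sq (x + y))
    rw [hx, hy, h] at this
    norm_num at this
    exact this
  have hle : ∀ i, ‖x i + y i‖ ^ 2 ≤ (‖x i‖ + ‖y i‖) ^ 2 := fun i =>
    pow_le_pow_left₀ (norm_nonneg _) (norm_add_le _ _) 2
  have hzero := (hasSum_zero_iff_of_nonneg fun i => by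
    change 0 ≤ 2 * ‖x i‖ ^ 2 + 2 * ‖y i‖ ^ 2 - ‖x i + y i‖ ^ 2
    nlinarith [hle i, sq_nonneg (‖x i‖ - ‖y i‖)]).1 hsum
  refine lp.ext (funext fun i => ?_)
  have h0 : 2 * ‖x i‖ ^ 2 + 2 * ‖y i‖ ^ 2 - ‖x i + y i‖ ^ 2 = 0 := congrFun hzero i
  have hn : ‖x i‖ = ‖y i‖ := by
    have : (‖x i‖ - ‖y i‖) ^ 2 ≤ 0 := by nlinarith [hle i]
    nlinarith [pow_eq_zero_iff (two_ne_zero) |>.1 (le_antisymm this (sq_nonneg _))]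
  have ha : ‖x i + y i‖ = ‖x i‖ + ‖y i‖ := by
    rw [← sq_eq_sq₀ (norm_nonneg _) (by positivity)]
    rw [hn] at h0 ⊢
    linarith
  exact (sameRay_iff_of_norm_eq hn).1 (sameRay_iff_norm_add.2 ha)

theorem lp.separableSpace_two [Countable ι] [∀ i, TopologicalSpace.SeparableSpace (E i)]
    [∀ i, NormedSpace ℝ (E i)] : TopologicalSpace.SeparableSpace (lp E 2) := by
  classical
  have hS : TopologicalSpace.IsSeparable
      (⋃ i, Set.range fun a : E i => (lp.single 2 i a : lp E 2)) :=
    .iUnion fun i => TopologicalSpace.isSeparable_range (lp.isometry_single i).continuous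
  rw [← TopologicalSpace.isSeparable_univ_iff]
  refine (hS.span (R := ℝ)).closure.mono fun x _ => ?_
  refine mem_closure_of_tendsto (lp.hasSum_single (by simp) x) (.of_forall fun s => ?_)
  exact Submodule.sum_mem _ fun i _ => Submodule.subset_span (Set.mem_iUnion.2 ⟨i, x i, rfl⟩)

end HilbertSum

/-! ### Clarkson's inequality and uniform convexity of `L^{2n}` -/

section Clarkson

/-- The pointwise form of **Clarkson's inequality** for an even exponent, a consequence of the
parallelogram law and of the convexity of `t ↦ t ^ n`. -/
theorem RCLike.norm_add_pow_add_norm_sub_pow_le {𝕜 : Type*} [RCLike 𝕜] (a b : 𝕜) {n : ℕ}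
    (hn : 1 ≤ n) :
    ‖a + b‖ ^ (2 * n) + ‖a - b‖ ^ (2 * n) ≤
      2 ^ (2 * n - 1) * (‖a‖ ^ (2 * n) + ‖b‖ ^ (2 * n)) := by
  have hpar : ‖a + b‖ ^ 2 + ‖a - b‖ ^ 2 = 2 * (‖a‖ ^ 2 + ‖b‖ ^ 2) := by
    have := parallelogram_law_with_norm 𝕜 a b
    simpa [sq] using this
  simp only [pow_mul]
  calc (‖a + b‖ ^ 2) ^ n + (‖a - b‖ ^ 2) ^ n ≤ (‖a + b‖ ^ 2 + ‖a - b‖ ^ 2) ^ n :=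
        pow_add_pow_le (by positivity) (by positivity) (by omega)
    _ = 2 ^ n * (‖a‖ ^ 2 + ‖b‖ ^ 2) ^ n := by rw [hpar, mul_pow]
    _ ≤ 2 ^ n * (2 ^ (n - 1) * ((‖a‖ ^ 2) ^ n + (‖b‖ ^ 2) ^ n)) := by
      gcongr
      exact add_pow_le (by positivity) (by positivity) n
    _ = 2 ^ (2 * n - 1) * ((‖a‖ ^ 2) ^ n + (‖b‖ ^ 2) ^ n) := by
      rw [← mul_assoc, ← pow_add]
      congr 2
      omega
    _ = _ := by rw [pow_sub₀ _ two_ne_zero (by omega), pow_mul]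

variable {𝕜 : Type*} [RCLike 𝕜] {X : Type*} [MeasurableSpace X] {μ : Measure X}

theorem MeasureTheory.Lp.norm_pow_eq_integral {m : ℕ} (hm : m ≠ 0) (f : Lp 𝕜 (m : ℝ≥0∞) μ) :
    ‖f‖ ^ m = ∫ x, ‖f x‖ ^ m ∂μ := by
  have hm' : (m : ℝ≥0∞) ≠ 0 := by exact_mod_cast hm
  rw [Lp.norm_def, (Lp.memLp f).eLpNorm_eq_integral_rpow_norm hm' (ENNReal.natCast_ne_top m),
    ENNReal.toReal_ofReal (by positivity)]
  simp only [ENNReal.toReal_natCast, Real.rpow_natCast]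
  exact Real.rpow_inv_natCast_pow (by positivity) hm

theorem MeasureTheory.Lp.integrable_norm_pow {m : ℕ} (hm : m ≠ 0) (f : Lp 𝕜 (m : ℝ≥0∞) μ) :
    Integrable (fun x => ‖f x‖ ^ m) μ :=
  (Lp.memLp f).integrable_norm_pow hm

/-- **Clarkson's inequality** in `L^{2n}`. -/
theorem MeasureTheory.Lp.norm_add_pow_add_norm_sub_pow_le {n : ℕ} (hn : 1 ≤ n)
    (f g : Lp 𝕜 ((2 * n : ℕ) : ℝ≥0∞) μ) :
    ‖f + g‖ ^ (2 * n) + ‖f - g‖ ^ (2 * n) ≤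
      2 ^ (2 * n - 1) * (‖f‖ ^ (2 * n) + ‖g‖ ^ (2 * n)) := by
  have hm : 2 * n ≠ 0 := by omega
  simp only [Lp.norm_pow_eq_integral hm]
  rw [← integral_add (Lp.integrable_norm_pow hm _) (Lp.integrable_norm_pow hm _),
    ← integral_add (Lp.integrable_norm_pow hm _) (Lp.integrable_norm_pow hm _),
    ← integral_const_mul]
  refine integral_mono_ae ((Lp.integrable_norm_pow hm _).add (Lp.integrable_norm_pow hm _))
    (((Lp.integrable_norm_pow hm _).add (Lp.integrable_norm_pow hm _)).const_mul _) ?_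
  filter_upwards [Lp.coeFn_add f g, Lp.coeFn_sub f g] with x h1 h2
  simp only [h1, h2, Pi.add_apply, Pi.sub_apply]
  exact RCLike.norm_add_pow_add_norm_sub_pow_le _ _ hn

instance MeasureTheory.Lp.uniformConvexSpace_two_mul (n : ℕ+) :
    UniformConvexSpace (Lp 𝕜 ((2 * (n : ℕ) : ℕ) : ℝ≥0∞) μ) where
  uniform_convex := by
    intro ε hε
    have hn : 1 ≤ (n : ℕ) := n.pos
    set m := 2 * (n : ℕ) with hm
    have hm0 : m ≠ 0 := by omega
    -- unit vectors with `‖x - y‖ ≥ ε` satisfy `‖x + y‖ ^ m ≤ 2 ^ m - ε ^ m`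
    set t : ℝ := max 0 (2 ^ m - ε ^ m) with ht
    set r : ℝ := t ^ ((m : ℝ)⁻¹) with hr
    have hrm : r ^ m = t := Real.rpow_inv_natCast_pow (le_max_left _ _) hm0
    have hr0 : 0 ≤ r := Real.rpow_nonneg (le_max_left _ _) _
    have hr2 : r < 2 := by
      refine lt_of_pow_lt_pow_left₀ m zero_le_two ?_
      rw [hrm, ht, max_lt_iff]
      exact ⟨by positivity, by linarith [pow_pos hε m]⟩
    refine ⟨2 - r, by linarith, fun x hx y hy hxy => ?_⟩
    rw [sub_sub_cancel]
    have h := Lp.norm_add_pow_add_norm_sub_pow_le hn x y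
    change ‖x + y‖ ^ m + ‖x - y‖ ^ m ≤ 2 ^ (m - 1) * (‖x‖ ^ m + ‖y‖ ^ m) at h
    rw [hx, hy, one_pow, one_add_one_eq_two, ← pow_succ, show m - 1 + 1 = m by omega] at h
    have h2 : ε ^ m ≤ ‖x - y‖ ^ m := pow_le_pow_left₀ hε.le hxy m
    refine le_of_pow_le_pow_left₀ hm0 hr0 ?_
    rw [hrm]
    exact le_max_of_le_right (by linarith)

end Clarkson

/-! ### Length functions and weighted word lengths -/

section LengthFunction

/-- A length function on a group: nonnegative, symmetric, subadditive, and `0` at the identity. -/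
structure IsLengthFunction {G : Type*} [Group G] (ℓ : G → ℝ) : Prop where
  nonneg : ∀ g, 0 ≤ ℓ g
  map_one : ℓ 1 = 0
  map_inv : ∀ g, ℓ g⁻¹ = ℓ g
  map_mul_le : ∀ g h, ℓ (g * h) ≤ ℓ g + ℓ h

/-- The infimum of the total weights of the words that represent a group element. -/
noncomputable def wordLength {G : Type*} [Group G] (w : G → ℝ) (g : G) : ℝ :=
  sInf {s | ∃ L : List G, L.prod = g ∧ (L.map w).sum = s}

theorem sum_map_nonneg_of_nonneg {α : Type*} {w : α → ℝ} (hw : ∀ g, 0 ≤ w g) (L : List α) :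
    0 ≤ (L.map w).sum :=
  List.sum_nonneg (by simpa using fun g _ => hw g)

variable {G : Type*} [Group G] {w p : G → ℝ}

theorem wordLength_le_sum (hw : ∀ g, 0 ≤ w g) (L : List G) :
    wordLength w L.prod ≤ (L.map w).sum :=
  csInf_le ⟨0, by rintro _ ⟨L, -, rfl⟩; exact sum_map_nonneg_of_nonneg hw L⟩ ⟨L, rfl, rfl⟩

theorem wordLength_le (hw : ∀ g, 0 ≤ w g) (g : G) : wordLength w g ≤ w g := by
  simpa using wordLength_le_sum hw [g]

theorem exists_word_of_wordLength_lt {g : G} {t : ℝ} (h : wordLength w g < t) :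
    ∃ L : List G, L.prod = g ∧ (L.map w).sum < t := by
  have hne : {s | ∃ L : List G, L.prod = g ∧ (L.map w).sum = s}.Nonempty := ⟨_, [g], by simp, rfl⟩
  obtain ⟨_, ⟨L, hL, rfl⟩, hlt⟩ := exists_lt_of_csInf_lt hne h
  exact ⟨L, hL, hlt⟩

theorem isLengthFunction_wordLength (hw : ∀ g, 0 ≤ w g) (hinv : ∀ g, w g⁻¹ = w g) :
    IsLengthFunction (wordLength w) := by
  have hnn : ∀ g, 0 ≤ wordLength w g := fun g =>
    Real.sInf_nonneg (by rintro _ ⟨L, -, rfl⟩; exact sum_map_nonneg_of_nonneg hw L)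
  have hinv' : ∀ g, wordLength w g⁻¹ ≤ wordLength w g := fun g => by
    refine le_of_forall_gt fun t ht => ?_
    obtain ⟨L, rfl, hL⟩ := exists_word_of_wordLength_lt ht
    rw [List.prod_inv_reverse]
    refine (wordLength_le_sum hw _).trans_lt ?_
    rw [List.map_reverse, List.sum_reverse, List.map_map]
    simpa [Function.comp_def, hinv] using hL
  refine ⟨hnn, le_antisymm ?_ (hnn 1), fun g => le_antisymm (hinv' g) ?_, fun g h => ?_⟩
  · simpa using wordLength_le_sum hw []
  · simpa using hinv' g⁻¹
  · refine le_of_forall_pos_lt_add fun ε hε => ?_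
    obtain ⟨L, rfl, hL⟩ :=
      exists_word_of_wordLength_lt (show wordLength w g < wordLength w g + ε / 2 by linarith)
    obtain ⟨M, rfl, hM⟩ :=
      exists_word_of_wordLength_lt (show wordLength w h < wordLength w h + ε / 2 by linarith)
    rw [← List.prod_append]
    refine (wordLength_le_sum hw _).trans_lt ?_
    rw [List.map_append, List.sum_append]
    linarith

/-- If `w` agrees with a length function `p` where `w < 1`, then the word length associated with
`w` is at least `p` where it is `< 1`. -/
theorem le_wordLength_of_lt_one (hw : ∀ g, 0 ≤ w g) (hp : IsLengthFunction p)
    (hwp : ∀ g, w g < 1 → w g = p g) {g : G} (hg : wordLength w g < 1) : p g ≤ wordLength w g := by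
  have key : ∀ L : List G, (L.map w).sum < 1 → p L.prod ≤ (L.map w).sum := by
    intro L
    induction L with
    | nil => simp [hp.map_one]
    | cons x L ih =>
      intro h
      simp only [List.map_cons, List.sum_cons, List.prod_cons] at h ⊢
      have h1 := hw x
      have h2 := sum_map_nonneg_of_nonneg hw L
      have h3 := hwp x (by linarith)
      linarith [ih (by linarith), hp.map_mul_le x L.prod]
  refine le_of_forall_gt_imp_ge_of_dense fun t ht => ?_
  obtain ⟨L, rfl, hL⟩ := exists_word_of_wordLength_lt (lt_min ht hg)
  exact (key L (hL.trans_le (min_le_right _ _))).trans (hL.le.trans (min_le_left _ _))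

end LengthFunction

/-! ### A length function generating the topology -/

section BirkhoffKakutani

open scoped Uniformity

variable {G : Type*} [Group G] [TopologicalSpace G] [IsTopologicalGroup G]

/-- A first countable group has a length function whose balls form a neighbourhood basis of the
identity. It is `g ↦ sup_x min 1 (dist x (x g))` for a pseudometric inducing the left
uniformity. -/
theorem exists_lengthFunction_hasBasis [FirstCountableTopology G] :
    ∃ ℓ : G → ℝ, IsLengthFunction ℓ ∧
      (𝓝 (1 : G)).HasBasis (fun ε : ℝ => 0 < ε) fun ε => {g | ℓ g < ε} := by
  let u : UniformSpace G := IsTopologicalGroup.leftUniformSpace G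
  have hu : 𝓤 G = comap (fun p : G × G => p.1⁻¹ * p.2) (𝓝 (1 : G)) := rfl
  have : (𝓤 G).IsCountablyGenerated := by rw [hu]; infer_instance
  obtain ⟨I, hI⟩ := UniformSpace.metrizable_uniformity G
  have hbasis : (𝓤 G).HasBasis (fun ε : ℝ => 0 < ε) fun ε => {p : G × G | I.dist p.1 p.2 < ε} := by
    rw [← hI]
    exact @Metric.uniformity_basis_dist G I
  have hI0 : ∀ x y, 0 ≤ I.dist x y := @dist_nonneg G I
  have hsymm : ∀ x y, I.dist x y = I.dist y x := I.dist_comm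
  have hself : ∀ x, I.dist x x = 0 := I.dist_self
  have htri : ∀ x y z, I.dist x z ≤ I.dist x y + I.dist y z := I.dist_triangle
  generalize I.dist = D at *
  let ℓ : G → ℝ := fun g => ⨆ x, min 1 (D x (x * g))
  have hbdd : ∀ g, BddAbove (Set.range fun x => min 1 (D x (x * g))) := fun g =>
    ⟨1, by rintro _ ⟨x, rfl⟩; exact min_le_left _ _⟩
  have hle : ∀ g x, min 1 (D x (x * g)) ≤ ℓ g := fun g x => le_ciSup (hbdd g) x
  have hinv : ∀ g, ℓ g⁻¹ ≤ ℓ g := fun g => ciSup_le fun x => by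
    simpa [hsymm] using hle g (x * g⁻¹)
  refine ⟨ℓ, ⟨fun g => Real.iSup_nonneg fun x => le_min zero_le_one (hI0 _ _), ?_,
    fun g => le_antisymm (hinv g) (by simpa using hinv g⁻¹), fun g h => ciSup_le fun x => ?_⟩, ?_⟩
  · simp [ℓ, hself]
  · have h1 := hle g x
    have h2 := hle h (x * g)
    have h3 := htri x (x * g) (x * g * h)
    have h4 := hI0 x (x * g)
    have h5 := hI0 (x * g) (x * g * h)
    rw [← mul_assoc]
    grind
  · refine ⟨fun U => ⟨fun hU => ?_, ?_⟩⟩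
    · obtain ⟨ε, hε, h⟩ := hbasis.mem_iff.1 (by rw [hu]; exact preimage_mem_comap hU)
      refine ⟨min 1 ε, lt_min one_pos hε, fun g hg => ?_⟩
      have h1 : min 1 (D 1 (1 * g)) < min 1 ε := (hle g 1).trans_lt hg
      have h2 : D 1 g < ε := by
        rw [one_mul] at h1
        grind
      simpa using h (show ((1 : G), g) ∈ {p : G × G | D p.1 p.2 < ε} from h2)
    · rintro ⟨ε, hε, h⟩
      have h1 := hbasis.mem_of_mem (half_pos hε)
      rw [hu, mem_comap] at h1
      obtain ⟨T, hT, hTs⟩ := h1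
      refine mem_of_superset hT fun g hg => h ?_
      refine lt_of_le_of_lt (ciSup_le fun x => ?_) (half_lt_self hε)
      refine (min_le_right _ _).trans (le_of_lt ?_)
      exact hTs (show (x, x * g) ∈ _ by simpa using hg)

end BirkhoffKakutani

/-! ### The metric of a length function -/

section LengthMetric

variable {G : Type*} [Group G] {ℓ : G → ℝ}

/-- The left invariant metric `d(x, y) = ℓ(x⁻¹ y)` associated with a length function. -/
@[reducible]
def IsLengthFunction.metricSpace (hℓ : IsLengthFunction ℓ) (h0 : ∀ g, ℓ g = 0 → g = 1) :
    MetricSpace G where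
  dist x y := ℓ (x⁻¹ * y)
  dist_self x := by simp [hℓ.map_one]
  dist_comm x y := by rw [← hℓ.map_inv]; simp
  dist_triangle x y z := by simpa [mul_assoc] using hℓ.map_mul_le (x⁻¹ * y) (y⁻¹ * z)
  eq_of_dist_eq_zero {x y} h := (inv_mul_eq_one.1 (h0 _ h))

/-- The metric of a length function is proper, left invariant and compatible with the topology if
the balls of the length function form a basis at the identity and are relatively compact. -/
theorem IsLengthFunction.isPligMetric [TopologicalSpace G] [IsTopologicalGroup G]
    (hℓ : IsLengthFunction ℓ) (h0 : ∀ g, ℓ g = 0 → g = 1)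
    (hbasis : (𝓝 (1 : G)).HasBasis (fun ε : ℝ => 0 < ε) fun ε => {g | ℓ g < ε})
    (hcpt : ∀ t : ℝ, ∃ C, IsCompact C ∧ {g | ℓ g < t} ⊆ C) :
    IsPligMetric (hℓ.metricSpace h0) := by
  have hgen : (hℓ.metricSpace h0).toUniformSpace.toTopologicalSpace = ‹TopologicalSpace G› := by
    refine TopologicalSpace.ext_nhds fun x => ?_
    have h1 := @Metric.nhds_basis_ball G (hℓ.metricSpace h0).toPseudoMetricSpace x
    have h2 : (𝓝 x).HasBasis (fun ε : ℝ => 0 < ε) fun ε => (x * ·) '' {g | ℓ g < ε} := by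
      rw [← map_mul_left_nhds_one x]
      exact hbasis.map _
    refine h1.eq_of_same_basis ?_
    convert h2 using 2 with ε
    ext y
    rw [Set.image_mul_left, @Metric.mem_ball', Set.mem_preimage]
    rfl
  refine ⟨?_, fun g x y => ?_, hgen⟩
  · refine @ProperSpace.mk G (hℓ.metricSpace h0).toPseudoMetricSpace fun x r => ?_
    rw [hgen]
    obtain ⟨C, hC, hsub⟩ := hcpt (r + 1)
    refine (hC.image (continuous_const_mul x)).of_isClosed_subset ?_ fun y hy => ?_
    · have := @Metric.isClosed_closedBall G (hℓ.metricSpace h0).toPseudoMetricSpace x r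
      rwa [hgen] at this
    · rw [@Metric.mem_closedBall'] at hy
      have hy' : ℓ (x⁻¹ * y) ≤ r := hy
      exact ⟨x⁻¹ * y, hsub (show ℓ (x⁻¹ * y) < r + 1 by linarith), by simp⟩
  · change ℓ ((g * x)⁻¹ * (g * y)) = ℓ (x⁻¹ * y)
    congr 1
    group

end LengthMetric

/-! ### Words of bounded cost -/

section WordSets

open scoped Pointwise

/-- The products of `m` letters, the `i`-th of them from a set `K kᵢ`, with `∑ W kᵢ < t`. -/
def wordSet {G : Type*} [Group G] (K : ℕ → Set G) (W : ℕ → ℝ) : ℕ → ℝ → Set G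
  | 0, t => {g | g = 1 ∧ 0 < t}
  | m + 1, t => ⋃ k, K k * wordSet K W m (t - W k)

variable {G : Type*} [Group G] {K : ℕ → Set G} {W : ℕ → ℝ}

theorem mul_mem_wordSet_succ {k m : ℕ} {t : ℝ} {g h : G} (hg : g ∈ K k)
    (hh : h ∈ wordSet K W m (t - W k)) : g * h ∈ wordSet K W (m + 1) t :=
  Set.mem_iUnion.2 ⟨k, Set.mul_mem_mul hg hh⟩

theorem wordSet_mono (h1 : (1 : G) ∈ K 0) (hW : W 0 = 0) (t : ℝ) :
    Monotone fun m => wordSet K W m t :=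
  monotone_nat_of_le_succ fun m g hg => by
    have : 1 * g ∈ wordSet K W (m + 1) t := mul_mem_wordSet_succ h1 (by rwa [hW, sub_zero])
    rwa [one_mul] at this

theorem wordSet_eq_empty_of_nonpos (hW : ∀ k, 0 ≤ W k) (m : ℕ) {t : ℝ} (ht : t ≤ 0) :
    wordSet K W m t = ∅ := by
  induction m generalizing t with
  | zero => simp [wordSet, ht.not_gt]
  | succ m ih =>
    simp only [wordSet]
    exact Set.iUnion_eq_empty.2 fun k => by rw [ih (by linarith [hW k]), Set.mul_empty]

/-- If only finitely many of the costs `W k` lie below any bound, the words of fixed length and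
bounded cost stay in a compact set. -/
theorem exists_isCompact_wordSet_subset [TopologicalSpace G] [IsTopologicalGroup G]
    (hK : ∀ k, IsCompact (K k)) (hW : ∀ k : ℕ, (k : ℝ) ≤ W k) (m : ℕ) (t : ℝ) :
    ∃ C, IsCompact C ∧ wordSet K W m t ⊆ C := by
  induction m generalizing t with
  | zero => exact ⟨{1}, isCompact_singleton, fun g hg => hg.1⟩
  | succ m ih =>
    choose C hC hsub using ih
    refine ⟨⋃ k ∈ Finset.range ⌈t⌉₊, K k * C (t - W k),
      (Finset.range ⌈t⌉₊).isCompact_biUnion fun k _ => (hK k).mul (hC _), ?_⟩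
    refine Set.iUnion_subset fun k => ?_
    rcases lt_or_ge (k : ℝ) t with hk | hk
    · refine Set.subset_iUnion₂_of_subset k ?_ (Set.mul_subset_mul_left (hsub _))
      rw [Finset.mem_range]
      exact Nat.lt_ceil.2 hk
    · rw [wordSet_eq_empty_of_nonpos (fun k => k.cast_nonneg.trans (hW k)) m
        (by linarith [hW k]), Set.mul_empty]
      exact Set.empty_subset _

/-- If prepending a letter from `K k` multiplies the measure of the `U`-neighbourhood of a set at
most by `N k`, then the words of length `m` and cost less than `t` fill a set of measure at most
`C ^ m * exp t`, where `C = ∑ N k * exp (- W k)`. -/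
theorem measure_mul_wordSet_le [MeasurableSpace G] {μ : Measure G} {U : Set G} {N : ℕ → ℕ}
    (hN : ∀ k A, μ (U * (K k * A)) ≤ N k * μ (U * A)) {C : ℝ≥0∞}
    (hC : ∑' k, N k * ENNReal.ofReal (Real.exp (-W k)) ≤ C) (m : ℕ) (t : ℝ) :
    μ (U * wordSet K W m t) ≤ C ^ m * ENNReal.ofReal (Real.exp t) * μ U := by
  induction m generalizing t with
  | zero =>
    rw [pow_zero, one_mul]
    rcases le_or_gt t 0 with ht | ht
    · have : wordSet K W 0 t = ∅ := by simp [wordSet, ht.not_gt]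
      simp [this]
    · have h1 : U * wordSet K W 0 t ⊆ U := by
        rintro _ ⟨u, hu, g, ⟨rfl, -⟩, rfl⟩
        simpa using hu
      calc μ (U * wordSet K W 0 t) ≤ 1 * μ U := by rw [one_mul]; exact measure_mono h1
        _ ≤ _ := by
          gcongr
          rw [ENNReal.one_le_ofReal]
          exact Real.one_le_exp ht.le
  | succ m ih =>
    simp only [wordSet, Set.mul_iUnion]
    calc μ (⋃ k, U * (K k * wordSet K W m (t - W k)))
        ≤ ∑' k, μ (U * (K k * wordSet K W m (t - W k))) := measure_iUnion_le _
      _ ≤ ∑' k, (N k * ENNReal.ofReal (Real.exp (-W k))) *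
            (C ^ m * ENNReal.ofReal (Real.exp t) * μ U) := by
        refine ENNReal.tsum_le_tsum fun k => (hN k _).trans ?_
        refine (mul_le_mul_right (ih (t - W k)) _).trans (le_of_eq ?_)
        rw [sub_eq_add_neg, Real.exp_add, ENNReal.ofReal_mul (Real.exp_nonneg _)]
        ring
      _ ≤ C * (C ^ m * ENNReal.ofReal (Real.exp t) * μ U) := by
        rw [ENNReal.tsum_mul_right]
        gcongr
      _ = _ := by ring

/-- Merging letters of small weight: a word of total weight less than `t`, preceded by a small
letter `v`, can be rewritten with at most `2 t + 1` letters. Two adjacent small letters are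
multiplied as long as their weights add up to less than `1`. -/
theorem exists_mul_prod_mem_wordSet {w p : G → ℝ} (hp : IsLengthFunction p) (hW : W 0 = 0)
    (hsmall : ∀ g, p g < 1 → w g = p g ∧ g ∈ K 0)
    (hbig : ∀ g, 1 ≤ p g → ∃ k, g ∈ K k ∧ w g = W k ∧ 1 ≤ W k) (L : List G) :
    ∀ v, p v < 1 → ∃ m : ℕ, (m : ℝ) ≤ 2 * (L.map w).sum + p v + 1 ∧
      ∀ t, p v + (L.map w).sum < t → v * L.prod ∈ wordSet K W m t := by
  have hone : p 1 < 1 := by rw [hp.map_one]; exact one_pos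
  induction L with
  | nil =>
    intro v hv
    refine ⟨1, by simpa using hp.nonneg v, fun t ht => mul_mem_wordSet_succ (hsmall v hv).2 ?_⟩
    exact ⟨rfl, by simpa [hW] using (hp.nonneg v).trans_lt (by simpa using ht)⟩
  | cons x L ih =>
    intro v hv
    simp only [List.map_cons, List.sum_cons, List.prod_cons]
    have hv0 := hp.nonneg v
    rcases lt_or_ge (p x) 1 with hx | hx
    · rw [(hsmall x hx).1]
      have hx0 := hp.nonneg x
      rcases lt_or_ge (p v + p x) 1 with hvx | hvx
      · have hmul := hp.map_mul_le v x
        obtain ⟨m, hm, H⟩ := ih (v * x) (hmul.trans_lt hvx)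
        refine ⟨m, by linarith, fun t ht => ?_⟩
        rw [← mul_assoc]
        exact H t (by linarith)
      · obtain ⟨m, hm, H⟩ := ih x hx
        refine ⟨m + 1, by push_cast; linarith, fun t ht => ?_⟩
        exact mul_mem_wordSet_succ (hsmall v hv).2 (H _ (by linarith))
    · obtain ⟨k, hk, hwk, hWk⟩ := hbig x hx
      obtain ⟨m, hm, H⟩ := ih 1 hone
      rw [hp.map_one] at hm H
      refine ⟨m + 2, by push_cast; linarith, fun t ht => ?_⟩
      refine mul_mem_wordSet_succ (hsmall v hv).2 (mul_mem_wordSet_succ hk ?_)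
      rw [← one_mul L.prod]
      exact H _ (by linarith)

end WordSets

/-! ### A proper metric with exponential growth -/

section ExpGrowth

open scoped Pointwise

variable {G : Type*} [Group G] [TopologicalSpace G] [IsTopologicalGroup G]

/-- A compact set `K` multiplies the measure of `U`-neighbourhoods by a bounded factor only, as
`U * K` is covered by finitely many translates of `U`. -/
theorem exists_measure_mul_mul_le [MeasurableSpace G] [BorelSpace G] (μ : Measure G)
    [μ.IsMulLeftInvariant] {U K : Set G} (hU : IsCompact U) (hU1 : U ∈ 𝓝 (1 : G))
    (hK : IsCompact K) : ∃ N : ℕ, ∀ A, μ (U * (K * A)) ≤ N * μ (U * A) := by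
  obtain ⟨T, hT⟩ := compact_covered_by_mul_left_translates (hU.mul hK)
    ⟨1, mem_interior_iff_mem_nhds.2 hU1⟩
  refine ⟨T.card, fun A => ?_⟩
  have hsub : U * (K * A) ⊆ ⋃ g ∈ T, (g * ·) ⁻¹' (U * A) := by
    rw [← mul_assoc]
    rintro _ ⟨x, hx, a, ha, rfl⟩
    obtain ⟨g, hg, hgx⟩ := Set.mem_iUnion₂.1 (hT hx)
    refine Set.mem_iUnion₂.2 ⟨g, hg, ?_⟩
    change g * (x * a) ∈ U * A
    rw [← mul_assoc]
    exact Set.mul_mem_mul hgx ha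
  calc μ (U * (K * A)) ≤ ∑ g ∈ T, μ ((g * ·) ⁻¹' (U * A)) :=
        (measure_mono hsub).trans (measure_biUnion_finset_le _ _)
    _ = T.card * μ (U * A) := by simp [measure_preimage_mul]

theorem tsum_mul_exp_neg_le {N : ℕ → ℕ} {W : ℕ → ℝ} (hW : ∀ k, k ≠ 0 → W k = N k + k)
    (hW0 : W 0 = 0) :
    ∑' k, (N k : ℝ≥0∞) * ENNReal.ofReal (Real.exp (-W k)) ≤ ((2 * (N 0 + 1) : ℕ) : ℝ≥0∞) := by
  have hterm : ∀ k, (N k : ℝ≥0∞) * ENNReal.ofReal (Real.exp (-W k)) ≤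
      ((N 0 + 1 : ℕ) : ℝ≥0∞) * 2⁻¹ ^ k := by
    intro k
    rcases eq_or_ne k 0 with rfl | hk
    · simp [hW0]
    have h1 : (N k : ℝ) * Real.exp (-W k) ≤ (2⁻¹ : ℝ) ^ k := by
      rw [hW k hk, neg_add, Real.exp_add, ← mul_assoc]
      have h2 : (N k : ℝ) * Real.exp (-N k) ≤ 1 := by
        rw [Real.exp_neg, ← div_eq_mul_inv, div_le_one (Real.exp_pos _)]
        linarith [Real.add_one_le_exp (N k : ℝ)]
      have h3 : Real.exp (-(k : ℝ)) ≤ (2⁻¹ : ℝ) ^ k := by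
        rw [Real.exp_neg, inv_pow, ← Real.exp_one_pow]
        gcongr
        linarith [Real.add_one_le_exp (1 : ℝ)]
      calc (N k : ℝ) * Real.exp (-N k) * Real.exp (-(k : ℝ)) ≤ 1 * (2⁻¹ : ℝ) ^ k := by gcongr
        _ = _ := one_mul _
    calc (N k : ℝ≥0∞) * ENNReal.ofReal (Real.exp (-W k))
        = ENNReal.ofReal ((N k : ℝ) * Real.exp (-W k)) := by
          rw [ENNReal.ofReal_mul (Nat.cast_nonneg _), ENNReal.ofReal_natCast]
      _ ≤ ENNReal.ofReal ((2⁻¹ : ℝ) ^ k) := ENNReal.ofReal_le_ofReal h1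
      _ = 1 * 2⁻¹ ^ k := by
        rw [ENNReal.ofReal_pow (by positivity), ENNReal.ofReal_inv_of_pos two_pos, one_mul]
        simp
      _ ≤ ((N 0 + 1 : ℕ) : ℝ≥0∞) * 2⁻¹ ^ k := by
        gcongr
        exact_mod_cast Nat.le_add_left 1 (N 0)
  refine (ENNReal.tsum_le_tsum hterm).trans (le_of_eq ?_)
  rw [ENNReal.tsum_mul_left, ENNReal.tsum_geometric, ENNReal.one_sub_inv_two, inv_inv]
  push_cast
  ring

/-- On a second countable locally compact group there is a proper left invariant compatible metric
whose balls have exponentially controlled Haar measure. It comes from the word length for a weight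
that is a local length function near the identity and grows fast enough along a compact
exhaustion. -/
theorem exists_isPligMetric_hasExpGrowth [T2Space G] [LocallyCompactSpace G]
    [SecondCountableTopology G] [MeasurableSpace G] [BorelSpace G] (μ : Measure G)
    [μ.IsHaarMeasure] : ∃ d : MetricSpace G, IsPligMetric d ∧ HasExpGrowth μ d := by
  obtain ⟨ℓ₀, hℓ₀, hbasis₀⟩ := exists_lengthFunction_hasBasis (G := G)
  obtain ⟨U, hU, hU1⟩ := exists_compact_mem_nhds (1 : G)
  obtain ⟨ε, hε, hεU⟩ := hbasis₀.mem_iff.1 hU1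
  -- rescale so that the open unit ball is contained in `U`
  let p : G → ℝ := fun g => ℓ₀ g / ε
  have hp : IsLengthFunction p :=
    ⟨fun g => div_nonneg (hℓ₀.nonneg g) hε.le, by simp [p, hℓ₀.map_one],
      fun g => by simp [p, hℓ₀.map_inv], fun g h => by
        simp only [p, ← add_div]
        gcongr
        exact hℓ₀.map_mul_le g h⟩
  have hpU : ∀ g, p g < 1 → g ∈ U := fun g hg => hεU (by simpa using (div_lt_one hε).1 hg)
  -- the letters: `U`, and a symmetric compact exhaustion
  let X : CompactExhaustion G := default
  let K : ℕ → Set G := fun k => if k = 0 then U else X k ∪ (X k)⁻¹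
  have hK : ∀ k, IsCompact (K k) := fun k => by
    rcases eq_or_ne k 0 with rfl | hk
    · simpa [K] using hU
    · simpa [K, hk] using (X.isCompact k).union (X.isCompact k).inv
  choose N hN using fun k => exists_measure_mul_mul_le μ hU hU1 (hK k)
  -- the cost of a letter from `K k`
  let W : ℕ → ℝ := fun k => if k = 0 then 0 else N k + k
  have hW0 : W 0 = 0 := rfl
  have hW : ∀ k, k ≠ 0 → W k = N k + k := fun k hk => if_neg hk
  have hWk : ∀ k : ℕ, (k : ℝ) ≤ W k := fun k => by
    rcases eq_or_ne k 0 with rfl | hk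
    · simp [hW0]
    · rw [hW k hk]
      linarith [(N k).cast_nonneg (α := ℝ)]
  let idx : G → ℕ := fun g => sInf {k | k ≠ 0 ∧ g ∈ K k}
  have hidx : ∀ g, idx g ≠ 0 ∧ g ∈ K (idx g) := fun g => by
    refine Nat.sInf_mem (s := {k | k ≠ 0 ∧ g ∈ K k}) ?_
    obtain ⟨k, hk⟩ := X.exists_mem g
    exact ⟨k + 1, k.succ_ne_zero, by
      simpa [K] using Or.inl (X.subset_succ k hk)⟩
  have hidx_inv : ∀ g, idx g⁻¹ = idx g := fun g => by
    refine congrArg sInf (Set.ext fun k => and_congr_right fun hk => ?_)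
    simp [K, hk, or_comm]
  have hone_le : ∀ g, 1 ≤ W (idx g) := fun g =>
    le_trans (by exact_mod_cast Nat.one_le_iff_ne_zero.2 (hidx g).1) (hWk _)
  let w : G → ℝ := fun g => if p g < 1 then p g else W (idx g)
  have hw : ∀ g, 0 ≤ w g := fun g => by
    by_cases h : p g < 1
    · simpa [w, h] using hp.nonneg g
    · simpa [w, h] using zero_le_one.trans (hone_le g)
  have hw_inv : ∀ g, w g⁻¹ = w g := fun g => by simp [w, hp.map_inv, hidx_inv]
  have hwp : ∀ g, w g < 1 → w g = p g := fun g hg => by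
    by_cases h : p g < 1
    · simp [w, h]
    · simp only [w, h, if_false] at hg
      exact absurd hg (hone_le g).not_gt
  have hsmall : ∀ g, p g < 1 → w g = p g ∧ g ∈ K 0 := fun g hg =>
    ⟨if_pos hg, hpU g hg⟩
  have hbig : ∀ g, 1 ≤ p g → ∃ k, g ∈ K k ∧ w g = W k ∧ 1 ≤ W k := fun g hg =>
    ⟨idx g, (hidx g).2, if_neg hg.not_gt, hone_le g⟩
  set ℓ := wordLength w with hℓdef
  have hℓ : IsLengthFunction ℓ := isLengthFunction_wordLength hw hw_inv
  have hpℓ : ∀ g, ℓ g < 1 → p g ≤ ℓ g := fun g => le_wordLength_of_lt_one hw hp hwp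
  have hball : ∀ n : ℕ, {g | ℓ g < n} ⊆ wordSet K W (2 * n + 1) n := fun n g hg => by
    obtain ⟨L, rfl, hL⟩ := exists_word_of_wordLength_lt hg
    obtain ⟨m, hm, H⟩ := exists_mul_prod_mem_wordSet hp hW0 hsmall hbig L 1
      (by rw [hp.map_one]; exact one_pos)
    rw [hp.map_one] at hm H
    have hmn : m ≤ 2 * n + 1 := by
      have : (m : ℝ) ≤ (2 * n + 1 : ℕ) := by push_cast; linarith
      exact_mod_cast this
    have := wordSet_mono (K := K) (mem_of_mem_nhds hU1) hW0 n hmn (H n (by linarith))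
    rwa [one_mul] at this
  have hbasis : (𝓝 (1 : G)).HasBasis (fun ε : ℝ => 0 < ε) fun ε => {g | ℓ g < ε} := by
    refine hbasis₀.to_hasBasis (fun r hr => ?_) fun r hr => ?_
    · refine ⟨min 1 (r / ε), by positivity, fun g hg => ?_⟩
      have h1 : ℓ g < min 1 (r / ε) := hg
      have h2 := (hpℓ g (h1.trans_le (min_le_left _ _))).trans_lt (h1.trans_le (min_le_right _ _))
      exact (div_lt_div_iff_of_pos_right hε).1 h2
    · refine ⟨min 1 r * ε, by positivity, fun g hg => ?_⟩
      have h1 : p g < min 1 r := (div_lt_iff₀ hε).2 hg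
      refine (wordLength_le hw g).trans_lt ?_
      rw [(hsmall g (h1.trans_le (min_le_left _ _))).1]
      exact h1.trans_le (min_le_right _ _)
  have h0 : ∀ g, ℓ g = 0 → g = 1 := fun g hg => by
    by_contra hne
    obtain ⟨r, hr, hsub⟩ := hbasis.mem_iff.1 (isOpen_compl_singleton.mem_nhds (Ne.symm hne))
    exact hsub (show ℓ g < r by rwa [hg]) rfl
  refine ⟨hℓ.metricSpace h0, hℓ.isPligMetric h0 hbasis fun t => ?_, ?_⟩
  · obtain ⟨C, hC, hsub⟩ := exists_isCompact_wordSet_subset hK hWk (2 * ⌈t⌉₊ + 1) (⌈t⌉₊ : ℕ)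
    exact ⟨C, hC, fun g hg => hsub (hball _ (lt_of_lt_of_le hg (Nat.le_ceil t)))⟩
  · -- `μ {ℓ < n} ≤ c ^ (2 n + 1) * exp n * μ U`
    set c : ℕ := 2 * (N 0 + 1) with hc
    have hc1 : (1 : ℝ) ≤ c := by exact_mod_cast (by omega : 1 ≤ c)
    have hμU : 0 < (μ U).toReal :=
      ENNReal.toReal_pos (μ.measure_pos_of_mem_nhds hU1).ne' hU.measure_lt_top.ne
    refine ⟨2 * Real.log c + 1, c * (μ U).toReal, by linarith [Real.log_nonneg hc1],
      by positivity, fun n => ?_⟩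
    have h1 : {y : G | ℓ (1⁻¹ * y) < n} ⊆ U * wordSet K W (2 * n + 1) n := fun y hy => by
      refine ⟨1, mem_of_mem_nhds hU1, y, hball n ?_, one_mul y⟩
      simpa using hy
    refine (measure_mono h1).trans
      ((measure_mul_wordSet_le hN (tsum_mul_exp_neg_le hW hW0) _ _).trans (le_of_eq ?_))
    have h2 : Real.exp ((2 * Real.log c + 1) * n) = (c : ℝ) ^ (2 * n) * Real.exp n := by
      rw [add_mul, one_mul, Real.exp_add, mul_right_comm, mul_comm _ (Real.log c),
        Real.exp_mul, Real.exp_log (by positivity)]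
      norm_cast
    rw [h2, ← ENNReal.ofReal_toReal hU.measure_lt_top.ne, ← hc, ← ENNReal.ofReal_natCast c,
      ← ENNReal.ofReal_pow (by positivity), ← ENNReal.ofReal_mul (by positivity),
      ← ENNReal.ofReal_mul (by positivity), ENNReal.toReal_ofReal ENNReal.toReal_nonneg]
    congr 1
    ring

end ExpGrowth

/-! ### Hilbert sums of isometric representations -/

section HilbertSumRep

variable {𝕜 : Type*} [RCLike 𝕜] {ι : Type*} {E : ι → Type*} [∀ i, NormedAddCommGroup (E i)]
  [∀ i, NormedSpace 𝕜 (E i)]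

theorem Memℓp.map_linearIsometryEquiv (e : ∀ i, E i ≃ₗᵢ[𝕜] E i) (x : lp E 2) :
    Memℓp (fun i => e i (x i)) 2 :=
  memℓp_two_of_summable (by simpa using (lp.hasSum_norm_sq x).summable)

/-- The linear isometry of an `ℓ²`-sum acting by `e i` on the `i`-th summand. -/
noncomputable def lp.mapLinearIsometryEquiv (e : ∀ i, E i ≃ₗᵢ[𝕜] E i) :
    lp E 2 ≃ₗᵢ[𝕜] lp E 2 where
  toFun x := ⟨fun i => e i (x i), Memℓp.map_linearIsometryEquiv e x⟩
  invFun x := ⟨fun i => (e i).symm (x i), Memℓp.map_linearIsometryEquiv (fun i => (e i).symm) x⟩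
  map_add' x y := lp.ext (funext fun i => map_add (e i) (x i) (y i))
  map_smul' c x := lp.ext (funext fun i => map_smul (e i) c (x i))
  left_inv x := lp.ext (funext fun i => (e i).symm_apply_apply (x i))
  right_inv x := lp.ext (funext fun i => (e i).apply_symm_apply (x i))
  norm_map' x := by
    rw [← sq_eq_sq₀ (norm_nonneg _) (norm_nonneg _)]
    refine (lp.hasSum_norm_sq _).unique ?_
    convert lp.hasSum_norm_sq x using 3 with i
    exact (e i).norm_map (x i)

@[simp]
theorem lp.mapLinearIsometryEquiv_apply (e : ∀ i, E i ≃ₗᵢ[𝕜] E i) (x : lp E 2) (i : ι) :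
    lp.mapLinearIsometryEquiv e x i = e i (x i) := rfl

/-- The `ℓ²`-sum of a family of isometric representations. -/
noncomputable def lp.sumRep {G : Type*} [Group G] (ρ : ∀ i, G →* (E i ≃ₗᵢ[𝕜] E i)) :
    G →* (lp E 2 ≃ₗᵢ[𝕜] lp E 2) where
  toFun g := lp.mapLinearIsometryEquiv fun i => ρ i g
  map_one' := LinearIsometryEquiv.ext fun x => lp.ext (funext fun i => by simp)
  map_mul' g h := LinearIsometryEquiv.ext fun x => lp.ext (funext fun i => by simp)

@[simp]
theorem lp.sumRep_apply {G : Type*} [Group G] (ρ : ∀ i, G →* (E i ≃ₗᵢ[𝕜] E i)) (g : G)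
    (x : lp E 2) (i : ι) : lp.sumRep ρ g x i = ρ i g (x i) := rfl

/-- Orbit maps of vectors with finite support are continuous, and they converge uniformly, the
representation being isometric. -/
theorem lp.continuous_sumRep {G : Type*} [Group G] [TopologicalSpace G]
    (ρ : ∀ i, G →* (E i ≃ₗᵢ[𝕜] E i)) (hρ : ∀ i x, Continuous fun g => ρ i g x) (x : lp E 2) :
    Continuous fun g => lp.sumRep ρ g x := by
  classical
  have hx := lp.hasSum_single (by simp) x
  have hunif : TendstoUniformly
      (fun (s : Finset ι) g => lp.sumRep ρ g (∑ i ∈ s, lp.single 2 i (x i)))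
      (fun g => lp.sumRep ρ g x) atTop := by
    rw [Metric.tendstoUniformly_iff]
    intro ε hε
    filter_upwards [hx.eventually (Metric.ball_mem_nhds x hε)] with s hs g
    rw [(lp.sumRep ρ g).dist_map, dist_comm]
    exact hs
  refine hunif.continuous (.of_forall fun s => ?_)
  simp only [map_sum]
  refine continuous_finsetSum _ fun i _ => ?_
  have hsingle : ∀ g, lp.sumRep ρ g (lp.single 2 i (x i)) = lp.single 2 i (ρ i g (x i)) := by
    intro g
    refine lp.ext (funext fun j => ?_)
    rw [lp.sumRep_apply, lp.single_apply, lp.single_apply]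
    rcases eq_or_ne j i with rfl | hj
    · simp
    · simp [Pi.single_eq_of_ne hj]
  simp only [hsingle]
  exact (lp.isometry_single i).continuous.comp (hρ i (x i))

end HilbertSumRep

/-! ### Affine isometric actions from cocycles -/

section AffineAction

variable {𝕜 : Type*} [RCLike 𝕜] {G : Type*} [Group G] {E : Type*} [NormedAddCommGroup E]
  [NormedSpace 𝕜 E]

/-- The affine isometric action `ξ ↦ π(g) ξ + b(g)` with linear part `π` and cocycle `b`. -/
noncomputable def affineActionOfCocycle (π : G →* (E ≃ₗᵢ[𝕜] E)) (b : G → E)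
    (hb : ∀ g h, b (g * h) = b g + π g (b h)) : G →* (E ≃ᵃⁱ[𝕜] E) :=
  MonoidHom.mk'
    (fun g => (π g).toAffineIsometryEquiv.trans (AffineIsometryEquiv.constVAdd 𝕜 E (b g)))
    fun g h => AffineIsometryEquiv.ext fun ξ => by
      simp [hb, add_assoc]

theorem affineActionOfCocycle_apply (π : G →* (E ≃ₗᵢ[𝕜] E)) (b : G → E)
    (hb : ∀ g h, b (g * h) = b g + π g (b h)) (g : G) (ξ : E) :
    affineActionOfCocycle π b hb g ξ = b g + π g ξ := by
  simp [affineActionOfCocycle]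

theorem affineActionOfCocycle_linearIsometryEquiv (π : G →* (E ≃ₗᵢ[𝕜] E)) (b : G → E)
    (hb : ∀ g h, b (g * h) = b g + π g (b h)) (g : G) :
    (affineActionOfCocycle π b hb g).linearIsometryEquiv = π g := by
  ext ξ
  have := (affineActionOfCocycle π b hb g).map_vadd 0 ξ
  simp only [affineActionOfCocycle_apply, vadd_eq_add, add_zero, map_zero] at this
  rw [add_comm] at this
  exact (add_right_cancel this).symm

/-- A cocycle of an isometric representation that tends to `0` at the identity is continuous, as
`‖b(g) - b(h)‖ = ‖b(h⁻¹ g)‖`. -/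
theorem continuous_of_cocycle [TopologicalSpace G] [IsTopologicalGroup G]
    (π : G →* (E ≃ₗᵢ[𝕜] E)) (b : G → E) (hb : ∀ g h, b (g * h) = b g + π g (b h))
    (h0 : Tendsto (fun g => ‖b g‖) (𝓝 1) (𝓝 0)) : Continuous b := by
  rw [continuous_iff_continuousAt]
  intro h
  rw [ContinuousAt, tendsto_iff_norm_sub_tendsto_zero]
  have hnorm : ∀ g, ‖b g - b h‖ = ‖b (h⁻¹ * g)‖ := fun g => by
    have := hb h (h⁻¹ * g)
    rw [mul_inv_cancel_left] at this
    rw [this, add_sub_cancel_left, (π h).norm_map]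
  simp only [hnorm]
  refine h0.comp ?_
  have : Tendsto (fun g => h⁻¹ * g) (𝓝 h) (𝓝 (h⁻¹ * h)) := (continuous_const_mul _).tendsto h
  rwa [inv_mul_cancel] at this

end AffineAction

/-! ### Left translation on `L^p` -/

section LeftTranslation

variable (𝕜 : Type*) [RCLike 𝕜] {G : Type*} [Group G] [TopologicalSpace G]
  [IsTopologicalGroup G] [MeasurableSpace G] [BorelSpace G] (μ : Measure G) [μ.IsMulLeftInvariant]
  (p : ℝ≥0∞) [Fact (1 ≤ p)]

/-- Left translation `(λ(g) f)(h) = f(g⁻¹ h)` as an isometric representation on `L^p(G, μ)`. -/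
noncomputable def leftTranslation : G →* (Lp 𝕜 p μ ≃ₗᵢ[𝕜] Lp 𝕜 p μ) where
  toFun g :=
    { toFun := fun f => DomMulAct.mk g⁻¹ • f
      invFun := fun f => DomMulAct.mk g • f
      map_add' := smul_add _
      map_smul' := fun c f => smul_comm _ c f
      left_inv := fun f => by
        change DomMulAct.mk g • DomMulAct.mk g⁻¹ • f = f
        rw [← mul_smul, ← DomMulAct.mk_mul, inv_mul_cancel, DomMulAct.mk_one, one_smul]
      right_inv := fun f => by
        change DomMulAct.mk g⁻¹ • DomMulAct.mk g • f = f
        rw [← mul_smul, ← DomMulAct.mk_mul, mul_inv_cancel, DomMulAct.mk_one, one_smul]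
      norm_map' := fun f => DomMulAct.norm_smul_Lp _ f }
  map_one' := LinearIsometryEquiv.ext fun f => by
    change DomMulAct.mk (1 : G)⁻¹ • f = f
    rw [inv_one, DomMulAct.mk_one, one_smul]
  map_mul' g h := LinearIsometryEquiv.ext fun f => by
    change DomMulAct.mk (g * h)⁻¹ • f = DomMulAct.mk g⁻¹ • DomMulAct.mk h⁻¹ • f
    rw [mul_inv_rev, DomMulAct.mk_mul, mul_smul]

variable {𝕜 μ p}

theorem leftTranslation_ae_eq (g : G) (f : Lp 𝕜 p μ) :
    ⇑(leftTranslation 𝕜 μ p g f) =ᵐ[μ] fun h => f (g⁻¹ * h) :=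
  DomMulAct.smul_Lp_ae_eq (DomMulAct.mk g⁻¹) f

theorem continuous_leftTranslation [R1Space G] [IsLocallyFiniteMeasure μ]
    [μ.InnerRegularCompactLTTop] (hp : p ≠ ∞) (f : Lp 𝕜 p μ) :
    Continuous fun g => leftTranslation 𝕜 μ p g f := by
  have := Fact.mk hp
  have h : Continuous fun g : G => DomMulAct.mk g⁻¹ • f :=
    (DomMulAct.continuous_mk.comp continuous_inv).smul continuous_const
  exact h

end LeftTranslation

/-! ### Norm estimates in `L^p` -/

section LpBounds

variable {𝕜 : Type*} [RCLike 𝕜] {X : Type*} [MeasurableSpace X] {μ : Measure X} {m : ℕ}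

theorem MeasureTheory.Lp.norm_le_of_ae_le_indicator (hm : m ≠ 0) {f : Lp 𝕜 (m : ℝ≥0∞) μ}
    {S : Set X} (hS : MeasurableSet S) {c M : ℝ} (hc : 0 ≤ c) (hM : 0 ≤ M)
    (hf : ∀ᵐ x ∂μ, ‖f x‖ ≤ S.indicator (fun _ => c) x) (hμ : μ S ≤ ENNReal.ofReal (M ^ m)) :
    ‖f‖ ≤ c * M := by
  have hm' : (m : ℝ≥0∞) ≠ 0 := by exact_mod_cast hm
  rw [Lp.norm_def]
  refine ENNReal.toReal_le_of_le_ofReal (mul_nonneg hc hM) ?_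
  calc eLpNorm f m μ ≤ eLpNorm (S.indicator fun _ => c) m μ := eLpNorm_mono_ae_real hf
    _ = ‖c‖ₑ * μ S ^ (1 / (m : ℝ)) := by
      rw [eLpNorm_indicator_const hS hm' (ENNReal.natCast_ne_top m), ENNReal.toReal_natCast]
    _ ≤ ‖c‖ₑ * ENNReal.ofReal (M ^ m) ^ (1 / (m : ℝ)) := by gcongr
    _ = ENNReal.ofReal (c * M) := by
      rw [ENNReal.ofReal_pow hM, one_div, ENNReal.pow_rpow_inv_natCast hm,
        Real.enorm_of_nonneg hc, ENNReal.ofReal_mul hc]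

theorem MeasureTheory.Lp.le_norm_of_ae_indicator_le (hm : m ≠ 0) {f : Lp 𝕜 (m : ℝ≥0∞) μ}
    {S : Set X} (hS : MeasurableSet S) {c δ : ℝ} (hc : 0 ≤ c) (hδ : 0 ≤ δ)
    (hf : ∀ᵐ x ∂μ, x ∈ S → c ≤ ‖f x‖) (hμ : ENNReal.ofReal (δ ^ m) ≤ μ S) :
    c * δ ≤ ‖f‖ := by
  have hm' : (m : ℝ≥0∞) ≠ 0 := by exact_mod_cast hm
  rw [Lp.norm_def, ← ENNReal.ofReal_le_iff_le_toReal (Lp.eLpNorm_ne_top f)]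
  calc ENNReal.ofReal (c * δ) = ‖c‖ₑ * ENNReal.ofReal (δ ^ m) ^ (1 / (m : ℝ)) := by
        rw [ENNReal.ofReal_pow hδ, one_div, ENNReal.pow_rpow_inv_natCast hm,
          Real.enorm_of_nonneg hc, ENNReal.ofReal_mul hc]
    _ ≤ ‖c‖ₑ * μ S ^ (1 / (m : ℝ)) := by gcongr
    _ = eLpNorm (S.indicator fun _ => c) m μ := by
      rw [eLpNorm_indicator_const hS hm' (ENNReal.natCast_ne_top m), ENNReal.toReal_natCast]
    _ ≤ eLpNorm f m μ := by
      refine eLpNorm_mono_ae ?_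
      filter_upwards [hf] with x hx
      by_cases hxS : x ∈ S
      · simpa [hxS, abs_of_nonneg hc] using hx hxS
      · simp [hxS]

end LpBounds

/-! ### The bump functions -/

section Bump

variable {G : Type*} [Group G] {d : MetricSpace G}

theorem bump_eq_max (n : ℕ+) (y : G) : bump d n y = max 0 (1 - d.dist 1 y / (n : ℕ)) := by
  have hn : (0 : ℝ) < (n : ℕ) := by exact_mod_cast n.pos
  unfold bump
  split_ifs with h
  · rw [max_eq_right]
    rw [sub_nonneg, div_le_one hn]
    exact h
  · rw [max_eq_left]
    rw [sub_nonpos, one_le_div hn]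
    exact (not_le.1 h).le

theorem abs_bump_sub_bump_le (n : ℕ+) (y z : G) :
    |bump d n y - bump d n z| ≤ |d.dist 1 y - d.dist 1 z| / (n : ℕ) := by
  have hn : (0 : ℝ) < (n : ℕ) := by exact_mod_cast n.pos
  rw [bump_eq_max, bump_eq_max]
  refine (abs_max_sub_max_le_max _ _ _ _).trans ?_
  rw [sub_self, abs_zero, max_eq_right (abs_nonneg _), sub_sub_sub_cancel_left, ← sub_div,
    abs_div, abs_of_pos hn, abs_sub_comm]

theorem bump_lipschitz (n : ℕ+) (y z : G) :
    |bump d n y - bump d n z| ≤ d.dist y z / (n : ℕ) := by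
  refine (abs_bump_sub_bump_le n y z).trans ?_
  gcongr
  rw [abs_le]
  have h1 := d.dist_triangle 1 y z
  have h2 := d.dist_triangle 1 z y
  rw [d.dist_comm z y] at h2
  constructor <;> linarith

theorem bump_nonneg (n : ℕ+) (y : G) : 0 ≤ bump d n y := by
  rw [bump_eq_max]
  exact le_max_left _ _

theorem bump_le_one (n : ℕ+) (y : G) : bump d n y ≤ 1 := by
  rw [bump_eq_max]
  refine max_le zero_le_one (sub_le_self _ (div_nonneg ?_ (Nat.cast_nonneg _)))
  exact @dist_nonneg G d.toPseudoMetricSpace 1 y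

theorem bump_eq_zero {n : ℕ+} {y : G} (h : (n : ℕ) ≤ d.dist 1 y) : bump d n y = 0 := by
  have hn : (0 : ℝ) < (n : ℕ) := by exact_mod_cast n.pos
  rw [bump_eq_max, max_eq_left]
  rw [sub_nonpos, one_le_div hn]
  exact h

theorem half_le_bump (n : ℕ+) {y : G} (h : d.dist 1 y ≤ 1 / 2) : 1 / 2 ≤ bump d n y := by
  have hn : (1 : ℝ) ≤ (n : ℕ) := by exact_mod_cast n.pos
  have h0 : 0 ≤ d.dist 1 y := @dist_nonneg G d.toPseudoMetricSpace 1 y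
  rw [bump_eq_max]
  refine le_max_of_le_right ?_
  linarith [div_le_self h0 hn]

theorem MetricSpace.continuous_dist_left {X : Type*} (d : MetricSpace X) (x : X) :
    @Continuous X ℝ d.toUniformSpace.toTopologicalSpace _ (d.dist x) :=
  continuous_const.dist continuous_id

theorem IsLengthFunction.abs_inv_mul_sub_le {ℓ : G → ℝ} (hℓ : IsLengthFunction ℓ) (g h : G) :
    |ℓ (g⁻¹ * h) - ℓ h| ≤ ℓ g := by
  have h1 := hℓ.map_mul_le g⁻¹ h
  have h2 := hℓ.map_mul_le g (g⁻¹ * h)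
  rw [hℓ.map_inv] at h1
  rw [mul_inv_cancel_left] at h2
  rw [abs_le]
  constructor <;> linarith

theorem HasExpGrowth.measure_ball_lt_top [MeasurableSpace G] {μ : Measure G}
    (hμ : HasExpGrowth μ d) (n : ℕ) : μ {y | d.dist 1 y < n} < ∞ := by
  obtain ⟨a, b, -, -, h⟩ := hμ
  exact (h n).trans_lt ENNReal.ofReal_lt_top

variable [TopologicalSpace G]

theorem IsPligMetric.isLengthFunction (hd : IsPligMetric d) :
    IsLengthFunction (d.dist 1) where
  nonneg := @dist_nonneg G d.toPseudoMetricSpace 1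
  map_one := d.dist_self 1
  map_inv g := by
    have := hd.left_invariant g 1 g⁻¹
    rw [mul_one, mul_inv_cancel] at this
    rw [← this, d.dist_comm]
  map_mul_le g h := by
    have := hd.left_invariant g 1 h
    rw [mul_one] at this
    rw [← this]
    exact d.dist_triangle 1 g (g * h)

theorem IsPligMetric.continuous_dist_one (hd : IsPligMetric d) : Continuous (d.dist 1) := by
  have h := MetricSpace.continuous_dist_left d 1
  rwa [hd.generates] at h

theorem IsPligMetric.tendsto_dist_one (hd : IsPligMetric d) :
    Tendsto (d.dist 1) (cocompact G) atTop := by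
  refine tendsto_atTop.2 fun R => ?_
  have hcpt : IsCompact {y | d.dist 1 y ≤ R} := by
    have := @ProperSpace.isCompact_closedBall G d.toPseudoMetricSpace hd.proper 1 R
    rw [hd.generates] at this
    convert this using 1
    ext y
    rw [@Metric.mem_closedBall']
    rfl
  filter_upwards [hcpt.compl_mem_cocompact] with y hy
  exact (not_le.1 (show ¬ d.dist 1 y ≤ R from hy)).le

theorem IsPligMetric.continuous_bump (hd : IsPligMetric d) (n : ℕ+) : Continuous (bump d n) := by
  have : bump d n = fun y => max 0 (1 - d.dist 1 y / (n : ℕ)) := funext (bump_eq_max n)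
  rw [this]
  exact continuous_const.max (continuous_const.sub (hd.continuous_dist_one.div_const _))

theorem IsPligMetric.measurableSet_ball [MeasurableSpace G] [BorelSpace G] (hd : IsPligMetric d)
    (r : ℝ) : MeasurableSet {y | d.dist 1 y < r} :=
  (isOpen_lt hd.continuous_dist_one continuous_const).measurableSet

variable (𝕜 : Type*) [RCLike 𝕜] [MeasurableSpace G] [BorelSpace G] {μ : Measure G}

theorem memLp_bump (hd : IsPligMetric d) (hμ : HasExpGrowth μ d) (n : ℕ+) (p : ℝ≥0∞) :
    MemLp (fun y => (bump d n y : 𝕜)) p μ := by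
  have hball := hd.measurableSet_ball (n : ℕ)
  have hind : MemLp ({y | d.dist 1 y < (n : ℕ)}.indicator fun _ => (1 : ℝ)) p μ :=
    memLp_indicator_const p hball 1 (.inr (hμ.measure_ball_lt_top n).ne)
  refine hind.mono (RCLike.continuous_ofReal.comp
    (hd.continuous_bump n)).measurable.aestronglyMeasurable (.of_forall fun y => ?_)
  rw [RCLike.norm_ofReal, abs_of_nonneg (bump_nonneg n y)]
  by_cases hy : d.dist 1 y < (n : ℕ)
  · have : y ∈ {y | d.dist 1 y < (n : ℕ)} := hy
    simpa [this] using bump_le_one n y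
  · rw [bump_eq_zero (not_lt.1 hy)]
    positivity

end Bump

/-! ### The cocycle and the affine action -/

section BumpCocycle

variable (𝕜 : Type*) [RCLike 𝕜] {G : Type*} [Group G] [TopologicalSpace G]
  [IsTopologicalGroup G] [MeasurableSpace G] [BorelSpace G] {μ : Measure G} [μ.IsMulLeftInvariant]
  {d : MetricSpace G}

/-- The coboundary `λ(g) φ_n - φ_n` in `L^{2n}(G, μ)`, where `φ_n` is the bump function. -/
noncomputable def bumpCoboundary (hd : IsPligMetric d) (hμ : HasExpGrowth μ d) (n : ℕ+) (g : G) :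
    Lp 𝕜 ((2 * (n : ℕ) : ℕ) : ℝ≥0∞) μ :=
  leftTranslation 𝕜 μ _ g ((memLp_bump 𝕜 hd hμ n _).toLp _) - (memLp_bump 𝕜 hd hμ n _).toLp _

theorem bumpCoboundary_ae_eq (hd : IsPligMetric d) (hμ : HasExpGrowth μ d) (n : ℕ+) (g : G) :
    ⇑(bumpCoboundary 𝕜 hd hμ n g) =ᵐ[μ]
      fun h => ((bump d n (g⁻¹ * h) - bump d n h : ℝ) : 𝕜) := by
  have hφ := (memLp_bump 𝕜 hd hμ n ((2 * (n : ℕ) : ℕ) : ℝ≥0∞)).coeFn_toLp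
  have hφg := (measurePreserving_mul_left μ g⁻¹).quasiMeasurePreserving.ae_eq_comp hφ
  filter_upwards [Lp.coeFn_sub (leftTranslation 𝕜 μ _ g ((memLp_bump 𝕜 hd hμ n _).toLp _))
    ((memLp_bump 𝕜 hd hμ n ((2 * (n : ℕ) : ℕ) : ℝ≥0∞)).toLp _),
    leftTranslation_ae_eq g ((memLp_bump 𝕜 hd hμ n ((2 * (n : ℕ) : ℕ) : ℝ≥0∞)).toLp _),
    hφ, hφg] with h h1 h2 h3 h4
  simp only [Function.comp_apply] at h4
  rw [bumpCoboundary, h1, Pi.sub_apply, h2, h3, h4, RCLike.ofReal_sub]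

/-- The norms of the coboundaries `λ(g) φ_n - φ_n` are at most `M d(e, g) / n`: the function is
bounded by `d(e, g) / n` and lives on the union of a ball of radius `n + 1` and a translate of it,
and the `2n`-th root of the measure of this set stays bounded. -/
theorem exists_norm_bumpCoboundary_le (hd : IsPligMetric d) (hμ : HasExpGrowth μ d) :
    ∃ M : ℝ, 0 ≤ M ∧ ∀ (n : ℕ+) (g : G),
      ‖bumpCoboundary 𝕜 hd hμ n g‖ ≤ d.dist 1 g / (n : ℕ) * M := by
  have hμ' := hμ
  obtain ⟨a, b, ha, hb, hgrowth⟩ := hμ'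
  have hmax : 1 ≤ max 1 (2 * b) := le_max_left _ _
  refine ⟨max 1 (2 * b) * Real.exp a, by positivity, fun n g => ?_⟩
  have hn : (0 : ℝ) < (n : ℕ) := by exact_mod_cast n.pos
  have hn1 : (1 : ℝ) ≤ (n : ℕ) := by exact_mod_cast n.pos
  set B : Set G := {y | d.dist 1 y < ((n + 1 : ℕ) : ℝ)} with hB
  have hBm : MeasurableSet B := hd.measurableSet_ball _
  have hBg : MeasurableSet ((g⁻¹ * ·) ⁻¹' B) := (measurable_const_mul g⁻¹) hBm
  have hg0 : 0 ≤ d.dist 1 g := hd.isLengthFunction.nonneg g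
  refine Lp.norm_le_of_ae_le_indicator (S := B ∪ (g⁻¹ * ·) ⁻¹' B) (by have := n.pos; omega)
    (hBm.union hBg) (by positivity) (by positivity) ?_ ?_
  · filter_upwards [bumpCoboundary_ae_eq 𝕜 hd hμ n g] with h hh
    rw [hh, RCLike.norm_ofReal]
    by_cases hS : h ∈ B ∪ (g⁻¹ * ·) ⁻¹' B
    · rw [Set.indicator_of_mem hS]
      refine (abs_bump_sub_bump_le n _ _).trans ?_
      gcongr
      exact hd.isLengthFunction.abs_inv_mul_sub_le g h
    · rw [Set.indicator_of_notMem hS]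
      simp only [Set.mem_union, not_or, Set.mem_preimage, hB, Set.mem_ofPred_eq, not_lt] at hS
      push_cast at hS
      rw [bump_eq_zero (by linarith [hS.1]), bump_eq_zero (by linarith [hS.2]), sub_zero, abs_zero]
  · have h1 : b * Real.exp (a * (n + 1 : ℕ)) + b * Real.exp (a * (n + 1 : ℕ)) ≤
        (max 1 (2 * b) * Real.exp a) ^ (2 * (n : ℕ)) := by
      have h2 : Real.exp (a * (n + 1 : ℕ)) ≤ Real.exp a ^ (2 * (n : ℕ)) := by
        rw [← Real.exp_nat_mul, Real.exp_le_exp]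
        push_cast
        nlinarith
      have h3 : 2 * b ≤ max 1 (2 * b) ^ (2 * (n : ℕ)) :=
        (le_max_right _ _).trans (le_self_pow₀ hmax (by have := n.pos; omega))
      rw [mul_pow, ← two_mul, ← mul_assoc]
      gcongr
    calc μ (B ∪ (g⁻¹ * ·) ⁻¹' B) ≤ μ B + μ ((g⁻¹ * ·) ⁻¹' B) := measure_union_le _ _
      _ = μ B + μ B := by rw [measure_preimage_mul]
      _ ≤ ENNReal.ofReal (b * Real.exp (a * (n + 1 : ℕ))) +
          ENNReal.ofReal (b * Real.exp (a * (n + 1 : ℕ))) := add_le_add (hgrowth _) (hgrowth _)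
      _ ≤ _ := by
        rw [← ENNReal.ofReal_add (by positivity) (by positivity)]
        exact ENNReal.ofReal_le_ofReal h1

/-- As long as `2n ≤ d(e, g)`, the functions `φ_n` and `λ(g) φ_n` have disjoint supports, and the
norms of their differences are bounded below independently of `n` and `g`. -/
theorem exists_le_norm_bumpCoboundary [μ.IsOpenPosMeasure] (hd : IsPligMetric d)
    (hμ : HasExpGrowth μ d) :
    ∃ δ : ℝ, 0 < δ ∧ ∀ (n : ℕ+) (g : G), 2 * (n : ℕ) ≤ d.dist 1 g →
      δ ≤ ‖bumpCoboundary 𝕜 hd hμ n g‖ := by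
  set B : Set G := {y | d.dist 1 y < 1 / 2} with hB
  have hBo : IsOpen B := isOpen_lt hd.continuous_dist_one continuous_const
  have hBpos : 0 < μ B := hBo.measure_pos μ ⟨1, by simp [hB]⟩
  obtain ⟨δ, hδ0, hδ⟩ := ENNReal.lt_iff_exists_nnreal_btwn.1 (lt_min hBpos one_pos)
  have hδ1 : δ ≤ 1 := by exact_mod_cast (hδ.trans_le (min_le_right _ _)).le
  have hδpos : 0 < δ := by exact_mod_cast hδ0
  refine ⟨1 / 2 * δ, by positivity, fun n g hg => ?_⟩
  have hn1 : (1 : ℝ) ≤ (n : ℕ) := by exact_mod_cast n.pos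
  refine Lp.le_norm_of_ae_indicator_le (S := B) (by have := n.pos; omega) hBo.measurableSet
    (by norm_num) δ.coe_nonneg ?_ ?_
  · filter_upwards [bumpCoboundary_ae_eq 𝕜 hd hμ n g] with h hh hhB
    have hhB' : d.dist 1 h < 1 / 2 := hhB
    have h1 := hd.isLengthFunction.map_mul_le (g⁻¹ * h) h⁻¹
    rw [mul_inv_cancel_right, hd.isLengthFunction.map_inv, hd.isLengthFunction.map_inv] at h1
    rw [hh, RCLike.norm_ofReal, bump_eq_zero (y := g⁻¹ * h) (by linarith), zero_sub, abs_neg]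
    exact (half_le_bump n hhB'.le).trans (le_abs_self _)
  · refine le_trans ?_ (hδ.le.trans (min_le_left _ _))
    rw [← ENNReal.ofReal_coe_nnreal]
    refine ENNReal.ofReal_le_ofReal (pow_le_of_le_one δ.coe_nonneg (by exact_mod_cast hδ1) ?_)
    have := n.pos
    omega

theorem summable_one_div_pnat_sq : Summable fun n : ℕ+ => (1 / ((n : ℕ) : ℝ)) ^ 2 := by
  have : Summable fun n : ℕ => (1 / (n : ℝ)) ^ 2 := by
    simp
  exact this.comp_injective PNat.coe_injective

/-- The cocycle `b(g) = ⨁ (λ(g) φ_n - φ_n)`. -/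
noncomputable def bumpCocycle (hd : IsPligMetric d) (hμ : HasExpGrowth μ d) (g : G) :
    SumLp 𝕜 μ :=
  ⟨fun n => bumpCoboundary 𝕜 hd hμ n g, by
    obtain ⟨M, -, hM⟩ := exists_norm_bumpCoboundary_le 𝕜 hd hμ
    refine memℓp_two_of_summable (.of_nonneg_of_le (fun n => by positivity) (fun n => ?_)
      (summable_one_div_pnat_sq.mul_right ((d.dist 1 g * M) ^ 2)))
    rw [← mul_pow]
    refine pow_le_pow_left₀ (norm_nonneg _) ((hM n g).trans (le_of_eq ?_)) 2
    ring⟩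

theorem bumpCocycle_apply (hd : IsPligMetric d) (hμ : HasExpGrowth μ d) (g : G) (n : ℕ+) :
    bumpCocycle 𝕜 hd hμ g n = bumpCoboundary 𝕜 hd hμ n g := rfl

/-- The left regular representation on `⨁ L^{2n}(G, μ)`. -/
noncomputable def leftRegularRep (μ : Measure G) [μ.IsMulLeftInvariant] :
    G →* (SumLp 𝕜 μ ≃ₗᵢ[𝕜] SumLp 𝕜 μ) :=
  lp.sumRep fun n : ℕ+ => leftTranslation 𝕜 μ ((2 * (n : ℕ) : ℕ) : ℝ≥0∞)

theorem bumpCocycle_mul (hd : IsPligMetric d) (hμ : HasExpGrowth μ d) (g h : G) :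
    bumpCocycle 𝕜 hd hμ (g * h) =
      bumpCocycle 𝕜 hd hμ g + leftRegularRep 𝕜 μ g (bumpCocycle 𝕜 hd hμ h) := by
  refine lp.ext (funext fun n => ?_)
  change bumpCoboundary 𝕜 hd hμ n (g * h) =
    bumpCoboundary 𝕜 hd hμ n g + leftTranslation 𝕜 μ _ g (bumpCoboundary 𝕜 hd hμ n h)
  simp only [bumpCoboundary, map_mul, map_sub, LinearIsometryEquiv.coe_mul, Function.comp_apply]
  abel

/-- The coordinatewise bounds `M d(e, g) / n` are square summable, so `‖b(g)‖ ≤ C d(e, g)`. -/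
theorem tendsto_norm_bumpCocycle_nhds_one (hd : IsPligMetric d) (hμ : HasExpGrowth μ d) :
    Tendsto (fun g => ‖bumpCocycle 𝕜 hd hμ g‖) (𝓝 1) (𝓝 0) := by
  obtain ⟨M, hM0, hM⟩ := exists_norm_bumpCoboundary_le 𝕜 hd hμ
  set S : ℝ := ∑' n : ℕ+, (1 / ((n : ℕ) : ℝ)) ^ 2 with hS
  have hS0 : 0 ≤ S := tsum_nonneg fun n => by positivity
  have hle : ∀ g, ‖bumpCocycle 𝕜 hd hμ g‖ ≤ √S * (d.dist 1 g * M) := fun g => by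
    have hg0 : 0 ≤ d.dist 1 g := hd.isLengthFunction.nonneg g
    refine le_of_sq_le_sq ?_ (by positivity)
    rw [mul_pow, Real.sq_sqrt hS0]
    refine hasSum_le (fun n => ?_) (lp.hasSum_norm_sq _)
      (summable_one_div_pnat_sq.hasSum.mul_right ((d.dist 1 g * M) ^ 2))
    rw [← mul_pow, bumpCocycle_apply]
    refine pow_le_pow_left₀ (norm_nonneg _) ((hM n g).trans (le_of_eq ?_)) 2
    ring
  refine squeeze_zero (fun g => norm_nonneg _) hle ?_
  have h := ((hd.continuous_dist_one.tendsto 1).mul_const M).const_mul √S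
  rwa [hd.isLengthFunction.map_one, zero_mul, mul_zero] at h

/-- About `d(e, g) / 2` coordinates of the cocycle have norm bounded below, so its norm tends to
infinity. -/
theorem tendsto_norm_bumpCocycle_cocompact [μ.IsOpenPosMeasure] (hd : IsPligMetric d)
    (hμ : HasExpGrowth μ d) :
    Tendsto (fun g => ‖bumpCocycle 𝕜 hd hμ g‖) (cocompact G) atTop := by
  obtain ⟨δ, hδ, H⟩ := exists_le_norm_bumpCoboundary 𝕜 hd hμ
  refine tendsto_atTop.2 fun R => ?_
  obtain ⟨N, hN⟩ := exists_nat_ge (R ^ 2 / δ ^ 2)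
  rw [div_le_iff₀ (by positivity)] at hN
  filter_upwards [hd.tendsto_dist_one.eventually_ge_atTop (2 * (N : ℝ))] with g hg
  refine le_of_sq_le_sq (hN.trans ?_) (norm_nonneg _)
  -- each of the first `N` coordinates of the cocycle has norm at least `δ`
  refine le_trans ?_ (lp.sum_norm_sq_le (bumpCocycle 𝕜 hd hμ g)
    ((Finset.range N).map ⟨Nat.succPNat, Nat.succPNat_injective⟩))
  rw [Finset.sum_map]
  calc (N : ℝ) * δ ^ 2 = ∑ _k ∈ Finset.range N, δ ^ 2 := by simp
    _ ≤ _ := by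
      refine Finset.sum_le_sum fun k hk => pow_le_pow_left₀ hδ.le (H _ g (le_trans ?_ hg)) 2
      have : ((k + 1 : ℕ) : ℝ) ≤ N := by exact_mod_cast Finset.mem_range.1 hk
      change 2 * ((k + 1 : ℕ) : ℝ) ≤ 2 * N
      linarith

end BumpCocycle

theorem mainTheorem3 {𝕜 : Type*} [RCLike 𝕜] {G : Type*} [Group G] [TopologicalSpace G]
    [IsTopologicalGroup G] [T2Space G] [LocallyCompactSpace G] [SecondCountableTopology G]
    [MeasurableSpace G] [BorelSpace G] (μ : Measure G) [μ.IsHaarMeasure] :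
    (CompleteSpace (SumLp 𝕜 μ) ∧ TopologicalSpace.SeparableSpace (SumLp 𝕜 μ) ∧
      StrictConvexSpace ℝ (SumLp 𝕜 μ) ∧ IsReflexiveSpace 𝕜 (SumLp 𝕜 μ)) ∧
    ∃ d : MetricSpace G, IsPligMetric d ∧ HasExpGrowth μ d ∧
      (∀ (n : ℕ+) (y z : G), |bump d n y - bump d n z| ≤ d.dist y z / (n : ℕ)) ∧
      ∃ α : G →* (SumLp 𝕜 μ ≃ᵃⁱ[𝕜] SumLp 𝕜 μ),
        IsLeftRegularRep (fun g => (α g).linearIsometryEquiv) ∧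
        (∀ (g : G) (n : ℕ+), ⇑((α g 0 : SumLp 𝕜 μ) n) =ᵐ[μ]
          fun h => ((bump d n (g⁻¹ * h) - bump d n h : ℝ) : 𝕜)) ∧
        (∀ ξ : SumLp 𝕜 μ, Continuous fun g : G => α g ξ) ∧
        IsProperAffineAction α := by
  have hp : ∀ n : ℕ+, Fact (((2 * (n : ℕ) : ℕ) : ℝ≥0∞) ≠ ∞) := fun n =>
    ⟨ENNReal.natCast_ne_top _⟩
  refine ⟨⟨inferInstance, lp.separableSpace_two, StrictConvexSpace.lp_two,
    IsReflexiveSpace.lp_two fun n => IsReflexiveSpace.of_uniformConvexSpace⟩, ?_⟩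
  obtain ⟨d, hd, hμ⟩ := exists_isPligMetric_hasExpGrowth μ
  refine ⟨d, hd, hμ, bump_lipschitz, ?_⟩
  let π := leftRegularRep 𝕜 μ
  let b := bumpCocycle 𝕜 hd hμ
  have hb : ∀ g h, b (g * h) = b g + π g (b h) := bumpCocycle_mul 𝕜 hd hμ
  have hα := affineActionOfCocycle_apply π b hb
  refine ⟨affineActionOfCocycle π b hb, fun g ξ n => ?_, fun g n => ?_, fun ξ => ?_, fun ξ => ?_⟩
  · beta_reduce
    rw [affineActionOfCocycle_linearIsometryEquiv]
    exact leftTranslation_ae_eq g (ξ n)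
  · rw [hα, map_zero, add_zero]
    exact bumpCoboundary_ae_eq 𝕜 hd hμ n g
  · simp only [hα]
    exact (continuous_of_cocycle π b hb (tendsto_norm_bumpCocycle_nhds_one 𝕜 hd hμ)).add
      (lp.continuous_sumRep _ (fun n f => continuous_leftTranslation (hp n).out f) ξ)
  · simp only [hα]
    refine tendsto_atTop_mono (fun g => ?_)
      (tendsto_atTop_add_const_right _ (-‖ξ‖) (tendsto_norm_bumpCocycle_cocompact 𝕜 hd hμ))
    have h := norm_sub_norm_le (b g) (-(π g ξ))
    rw [sub_neg_eq_add, norm_neg, (π g).norm_map] at h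
    linarith
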